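/- Let $k$ be a field. For a commutative ring $R$ and an integer $n\ge 0$, let $\mathcal F_n(R)$ be the set of pairs $(A,B)$ of polynomials in $R[X]$, written $\frac AB$, such that $A$ is monic of degree $n$, $\deg B<n$, and the resultant $\mathrm{res}_{n,n}(A,B)$ is invertible in $R$. Let $\mathcal S_n(R)$ be the set of symmetric $n\times n$ matrices over $R$ with invertible determinant. For $\mathcal G=\mathcal F_n$ or $\mathcal S_n$, let $(\pi_0^{\mathrm N}\mathcal G)(k)$ be the quotient of $\mathcal G(k)$ by the equivalence relation generated by $H(0)\sim H(1)$ for $H\in\mathcal G(k[T])$, where $H(t)$ is the evaluation of $H$ at $T=t$. For $\frac{A}{B}\in\mathcal F_n(R)$ there is a unique pair $(U,V)$ of polynomials in $R[X]$ with $AU+BV=1$, $\deg U\le n-2$ and $\deg V\le n-1$ (for $n=0$, where $\frac AB=\frac10$, take $U=1$ and $V=0$). For $\frac{A_i}{B_i}\in\mathcal F_{n_i}(R)$ with associated pairs $(U_i,V_i)$, $i=1,2$, put $$\frac{A_1}{B_1}\oplus^{\mathrm N}\frac{A_2}{B_2}:=\frac{A_1A_2-V_1B_2}{B_1A_2+U_1B_2}\in\mathcal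 F_{n_1+n_2}(R).$$ The Bézout form $\mathrm{B\acute ez}_n\!\left(\frac AB\right)\in\mathcal S_n(R)$ is the matrix $[c_{p,q}]_{1\le p,q\le n}$ defined by $$\frac{A(X)B(Y)-A(Y)B(X)}{X-Y}=\sum_{1\le p,q\le n}c_{p,q}X^{p-1}Y^{q-1}$$ (the empty matrix for $n=0$). The law $\oplus^{\mathrm N}$ and the orthogonal (block diagonal) sum $\oplus$ induce graded monoid structures on $\coprod_{n\ge0}(\pi_0^{\mathrm N}\mathcal F_n)(k)$ and $\coprod_{n\ge0}(\pi_0^{\mathrm N}\mathcal S_n)(k)$ respectively, and $\mathrm{B\acute ez}_n$ induces maps $\pi_0^{\mathrm N}\mathrm{B\acute ez}_n:(\pi_0^{\mathrm N}\mathcal F_n)(k)\to(\pi_0^{\mathrm N}\mathcal S_n)(k)$. **Theorem.** For every field $k$, the map $$\coprod_{n\ge0}\pi_0^{\mathrm N}\mathrm{B\acute ez}_n:\Bigl(\coprod_{n\ge 0}(\pi_0^{\mathrm N}\mathcal F_n)(k),\oplus^{\mathrm N}\Bigr)\longrightarrow\Bigl(\coprod_{n\ge 0}(\pi_0^{\mathrm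 N}\mathcal S_n)(k),\oplus\Bigr)$$ is an isomorphism of graded monoids. -/

import Mathlib

open Polynomial

namespace NaiveP1

universe u

/-! ### Pointed rational functions -/

/-- An `R`-point of the scheme `𝓕ₙ` of pointed rational functions of degree `n`: a pair `(A, B)`
of polynomials with `A` monic of degree `n`, `deg B < n`, and with invertible resultant
`res_{n,n}(A, B)`. (`A` monic of degree `n` is phrased so as to make sense over the zero ring.) -/
@[ext]
structure RatFun (n : ℕ) (R : Type u) [CommRing R] where
  A : R[X]
  B : R[X]
  natDegree_A_le : A.natDegree ≤ n
  coeff_A : A.coeff n = 1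
  degree_B_lt : B.degree < n
  isUnit_res : IsUnit (A.resultant B n n)

/-- The data `(U, V)` attached to a pointed rational function `A / B` of degree `n`:
`A U + B V = 1`, `deg V ≤ n - 1`, `deg U ≤ n - 2`. In degree `0`, where `A / B = 1 / 0`, the bound
on `U` is void, and `(U, V) = (1, 0)`. -/
structure IsBezout {R : Type u} [CommRing R] (n : ℕ) (A B U V : R[X]) : Prop where
  rel : A * U + B * V = 1
  degree_V_lt : V.degree < n
  degree_U_lt : 1 ≤ n → U.degree < (n - 1 : ℕ)

/-- The set of naive connected components: the coequalizer of the two maps `σ, τ : 𝓖(R[T]) ⇉ 𝓖(R)`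
(evaluation at `T = 0` and at `T = 1`), i.e. the quotient of `𝓖(R)` by the equivalence relation
generated by `σ h ∼ τ h` for `h ∈ 𝓖(R[T])`. -/
def NaivePi0 {P Q : Type*} (σ τ : P → Q) : Type _ :=
  Quot fun a b : Q => ∃ h : P, σ h = a ∧ τ h = b

section Aux

variable {R : Type u} [CommRing R]

theorem degree_lt_of_monic_mul {A S : R[X]} (hA : A.Monic) (hlt : (A * S).degree < A.degree) :
    S = 0 := by
  by_contra hS
  rw [mul_comm, hA.degree_mul] at hlt
  have h0 : (0 : WithBot ℕ) ≤ S.degree := zero_le_degree_iff.2 hS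
  have : A.degree ≤ S.degree + A.degree := by
    simpa using add_le_add_left h0 A.degree
  exact absurd hlt (not_lt.2 this)

theorem degree_le_pred {n : ℕ} (_ : 1 ≤ n) {P : R[X]} (hP : P.degree < n) :
    P.degree ≤ ((n - 1 : ℕ) : WithBot ℕ) := by
  rcases eq_or_ne P 0 with rfl | h0
  · simp
  · rw [degree_eq_natDegree h0] at hP ⊢
    have : P.natDegree < n := by exact_mod_cast hP
    exact_mod_cast Nat.le_sub_one_of_lt this

theorem IsBezout.unique {n : ℕ} {A B U V U' V' : R[X]} (hA1 : A.natDegree ≤ n)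
    (hA2 : A.coeff n = 1) (h : IsBezout n A B U V) (e2 : A * U' + B * V' = 1)
    (hdV' : V'.degree < n) :
    U = U' ∧ V = V' := by
  nontriviality R
  have hA : A.Monic := monic_of_natDegree_le_of_coeff_eq_one n hA1 hA2
  have hdeg : A.degree = n := by
    rw [degree_eq_natDegree hA.ne_zero]
    have := le_natDegree_of_ne_zero (p := A) (n := n) (by rw [hA2]; exact one_ne_zero)
    exact_mod_cast le_antisymm hA1 this
  have e1 := h.rel
  have hV : V = V' := by
    have key : V - V' = A * (U * (V - V') + V * (U' - U)) := by
      linear_combination (V' - V) * e1 + V * (e1 - e2)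
    have hz := degree_lt_of_monic_mul hA (S := U * (V - V') + V * (U' - U)) (by
      rw [← key, hdeg]
      exact lt_of_le_of_lt (degree_sub_le _ _) (max_lt h.degree_V_lt hdV'))
    rw [hz, mul_zero] at key
    exact sub_eq_zero.1 key
  refine ⟨?_, hV⟩
  apply hA.isRegular.left
  subst hV
  show A * U = A * U'
  linear_combination e1 - e2

end Aux

namespace RatFun

variable {R : Type u} [CommRing R] {S : Type u} [CommRing S] {n m p : ℕ}

theorem monic (f : RatFun n R) : f.A.Monic :=
  monic_of_natDegree_le_of_coeff_eq_one n f.natDegree_A_le f.coeff_A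

theorem degree_A [Nontrivial R] (f : RatFun n R) : f.A.degree = n := by
  rw [degree_eq_natDegree f.monic.ne_zero]
  have := le_natDegree_of_ne_zero (p := f.A) (n := n) (by rw [f.coeff_A]; exact one_ne_zero)
  exact_mod_cast le_antisymm f.natDegree_A_le this

theorem isUnit_res_iff {A B : R[X]} (h1 : A.natDegree ≤ n) (h2 : A.coeff n = 1)
    (h3 : B.degree < n) : IsUnit (A.resultant B n n) ↔ IsCoprime A B := by
  rcases subsingleton_or_nontrivial R with hR | hR
  · exact ⟨fun _ => ⟨0, 0, Subsingleton.elim _ _⟩, fun _ => isUnit_of_subsingleton _⟩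
  have hA : A.Monic := monic_of_natDegree_le_of_coeff_eq_one n h1 h2
  have hn : A.natDegree = n :=
    le_antisymm h1 (le_natDegree_of_ne_zero (by rw [h2]; exact one_ne_zero))
  have hB : B.natDegree ≤ n := natDegree_le_of_degree_le h3.le
  have : A.resultant B n n = A.resultant B := by
    obtain ⟨j, hj⟩ := Nat.exists_eq_add_of_le hB
    have := resultant_add_right_deg A B n B.natDegree j le_rfl
    rw [← hj, h2, one_pow, one_mul] at this
    rw [this, hn]
  rw [this, isUnit_resultant_iff_isCoprime hA]

theorem isCoprime (f : RatFun n R) : IsCoprime f.A f.B :=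
  (isUnit_res_iff f.natDegree_A_le f.coeff_A f.degree_B_lt).1 f.isUnit_res

/-- Existence of the pair `(U, V)`. -/
theorem exists_isBezout (f : RatFun n R) : ∃ U V : R[X], IsBezout n f.A f.B U V := by
  rcases subsingleton_or_nontrivial R with hR | hR
  · exact ⟨0, 0, Subsingleton.elim _ _, by simp, by simp⟩
  obtain ⟨a, b, hab⟩ := f.isCoprime
  have hdiv := modByMonic_add_div b f.A
  have e : f.A * (a + f.B * (b /ₘ f.A)) + f.B * (b %ₘ f.A) = 1 := by
    linear_combination hab + f.B * hdiv
  have hV : (b %ₘ f.A).degree < n := by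
    rw [← f.degree_A]; exact degree_modByMonic_lt _ f.monic
  refine ⟨a + f.B * (b /ₘ f.A), b %ₘ f.A, e, hV, fun hn => ?_⟩
  generalize a + f.B * (b /ₘ f.A) = U at *
  generalize b %ₘ f.A = V at *
  by_contra hU
  rw [not_lt] at hU
  have h1 : f.A * U = 1 - f.B * V := by linear_combination e
  have h2 : (f.A * U).degree = U.degree + n := by
    rw [mul_comm, f.monic.degree_mul, f.degree_A]
  have hB' : f.B.degree ≤ ((n - 1 : ℕ) : WithBot ℕ) := degree_le_pred hn f.degree_B_lt
  have hV' : V.degree ≤ ((n - 1 : ℕ) : WithBot ℕ) := degree_le_pred hn hV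
  have h3 : (1 - f.B * V).degree ≤ ((n - 1 : ℕ) : WithBot ℕ) + ((n - 1 : ℕ) : WithBot ℕ) := by
    refine (degree_sub_le _ _).trans (max_le ?_ ?_)
    · refine degree_one_le.trans ?_
      exact_mod_cast Nat.zero_le _
    · exact (degree_mul_le _ _).trans (add_le_add hB' hV')
  rw [← h1, h2] at h3
  have h4 : ((n - 1 : ℕ) : WithBot ℕ) + (n : WithBot ℕ) ≤
      ((n - 1 : ℕ) : WithBot ℕ) + ((n - 1 : ℕ) : WithBot ℕ) :=
    (add_le_add_left hU _).trans h3
  have h5 : (n - 1) + n ≤ (n - 1) + (n - 1) := by exact_mod_cast h4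
  omega

/-- The polynomial `U` in the Bézout relation of `A / B`. -/
noncomputable def U (f : RatFun n R) : R[X] := f.exists_isBezout.choose

/-- The polynomial `V` in the Bézout relation of `A / B`. -/
noncomputable def V (f : RatFun n R) : R[X] := f.exists_isBezout.choose_spec.choose

theorem isBezout (f : RatFun n R) : IsBezout n f.A f.B f.U f.V :=
  f.exists_isBezout.choose_spec.choose_spec

theorem degree_U_le (f : RatFun n R) : f.U.degree ≤ n := by
  rcases Nat.eq_zero_or_pos n with rfl | hn
  · have h := f.isBezout.rel
    have hB : f.B = 0 := by
      have := f.degree_B_lt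
      rw [← degree_eq_bot]
      simpa using! (Nat.WithBot.lt_zero_iff.1 this)
    have hA : f.A = 1 := by
      have := f.coeff_A
      rw [eq_C_of_natDegree_le_zero f.natDegree_A_le, this, C_1]
    rw [hB, hA, zero_mul, add_zero, one_mul] at h
    rw [h]
    exact_mod_cast degree_one_le
  · exact (f.isBezout.degree_U_lt hn).le.trans (by exact_mod_cast Nat.sub_le n 1)

theorem degree_A_le (f : RatFun n R) : f.A.degree ≤ n :=
  degree_le_of_natDegree_le f.natDegree_A_le

/-- Functoriality of `𝓕ₙ` in the ring. -/
noncomputable def map (φ : R →+* S) (f : RatFun n R) : RatFun n S where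
  A := f.A.map φ
  B := f.B.map φ
  natDegree_A_le := natDegree_map_le.trans f.natDegree_A_le
  coeff_A := by rw [coeff_map, f.coeff_A, map_one]
  degree_B_lt := degree_map_le.trans_lt f.degree_B_lt
  isUnit_res := by rw [resultant_map_map]; exact f.isUnit_res.map φ

theorem isBezout_map (φ : R →+* S) (f : RatFun n R) :
    IsBezout n (f.map φ).A (f.map φ).B (f.U.map φ) (f.V.map φ) where
  rel := by
    have := congrArg (Polynomial.map φ) f.isBezout.rel
    simpa [map] using this
  degree_V_lt := degree_map_le.trans_lt f.isBezout.degree_V_lt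
  degree_U_lt := fun hn => degree_map_le.trans_lt (f.isBezout.degree_U_lt hn)

theorem U_map (φ : R →+* S) (f : RatFun n R) : (f.map φ).U = f.U.map φ :=
  (IsBezout.unique (f.map φ).natDegree_A_le (f.map φ).coeff_A (f.map φ).isBezout
    (f.isBezout_map φ).rel (f.isBezout_map φ).degree_V_lt).1

theorem V_map (φ : R →+* S) (f : RatFun n R) : (f.map φ).V = f.V.map φ :=
  (IsBezout.unique (f.map φ).natDegree_A_le (f.map φ).coeff_A (f.map φ).isBezout
    (f.isBezout_map φ).rel (f.isBezout_map φ).degree_V_lt).2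

theorem degree_mul_lt_left {P Q : R[X]} (hP : P.degree < n) (hQ : Q.degree ≤ m) :
    (P * Q).degree < ((n + m : ℕ) : WithBot ℕ) := by
  rcases eq_or_ne P 0 with rfl | h0
  · simp
  · rw [degree_eq_natDegree h0] at hP
    have hP' : P.natDegree < n := by exact_mod_cast hP
    refine (degree_mul_le _ _).trans_lt ?_
    rw [degree_eq_natDegree h0]
    refine (add_le_add_right hQ _).trans_lt ?_
    exact_mod_cast Nat.add_lt_add_right hP' m

theorem degree_mul_lt_right {P Q : R[X]} (hP : P.degree ≤ n) (hQ : Q.degree < m) :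
    (P * Q).degree < ((n + m : ℕ) : WithBot ℕ) := by
  rw [mul_comm, add_comm]
  exact degree_mul_lt_left hQ hP

theorem isCoprime_add (f : RatFun n R) (g : RatFun m R) :
    (f.A * g.A - f.V * g.B) * (f.U * g.U - f.B * g.V) +
      (f.B * g.A + f.U * g.B) * (f.A * g.V + f.V * g.U) = 1 := by
  linear_combination (g.A * g.U + g.B * g.V) * f.isBezout.rel + g.isBezout.rel

/-- The naive sum `A₁/B₁ ⊕ᴺ A₂/B₂ = A₃/B₃`, where
`[A₃, -V₃; B₃, U₃] = [A₁, -V₁; B₁, U₁] * [A₂, -V₂; B₂, U₂]`, that is,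
`A₃ = A₁ A₂ - V₁ B₂` and `B₃ = B₁ A₂ + U₁ B₂`. -/
noncomputable def add (f : RatFun n R) (g : RatFun m R) : RatFun (n + m) R :=
  have hA : (f.A * g.A - f.V * g.B).natDegree ≤ n + m := by
    refine natDegree_le_of_degree_le ((degree_sub_le _ _).trans (max_le ?_ ?_))
    · refine (degree_mul_le _ _).trans ?_
      exact_mod_cast add_le_add f.degree_A_le g.degree_A_le
    · exact (degree_mul_lt_left f.isBezout.degree_V_lt g.degree_B_lt.le).le
  have hA' : (f.A * g.A - f.V * g.B).coeff (n + m) = 1 := by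
    rw [coeff_sub,
      coeff_eq_zero_of_degree_lt (degree_mul_lt_left f.isBezout.degree_V_lt g.degree_B_lt.le),
      coeff_mul_add_eq_of_natDegree_le f.natDegree_A_le g.natDegree_A_le, f.coeff_A, g.coeff_A]
    simp
  have hB : (f.B * g.A + f.U * g.B).degree < ((n + m : ℕ) : WithBot ℕ) :=
    (degree_add_le _ _).trans_lt (max_lt (degree_mul_lt_left f.degree_B_lt g.degree_A_le)
      (degree_mul_lt_right f.degree_U_le g.degree_B_lt))
  { A := f.A * g.A - f.V * g.B
    B := f.B * g.A + f.U * g.B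
    natDegree_A_le := hA
    coeff_A := hA'
    degree_B_lt := hB
    isUnit_res := (isUnit_res_iff hA hA' hB).2
      ⟨f.U * g.U - f.B * g.V, f.A * g.V + f.V * g.U, by
        linear_combination isCoprime_add f g⟩ }

theorem add_A (f : RatFun n R) (g : RatFun m R) : (f.add g).A = f.A * g.A - f.V * g.B := rfl

theorem add_B (f : RatFun n R) (g : RatFun m R) : (f.add g).B = f.B * g.A + f.U * g.B := rfl

theorem add_UV (f : RatFun n R) (g : RatFun m R) :
    (f.add g).U = f.U * g.U - f.B * g.V ∧ (f.add g).V = f.A * g.V + f.V * g.U := by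
  refine IsBezout.unique (f.add g).natDegree_A_le (f.add g).coeff_A (f.add g).isBezout
    (isCoprime_add f g) ?_
  exact (degree_add_le _ _).trans_lt (max_lt
    (degree_mul_lt_right f.degree_A_le g.isBezout.degree_V_lt)
    (degree_mul_lt_left f.isBezout.degree_V_lt g.degree_U_le))

/-- The unique pointed rational function `1 / 0` of degree `0`. -/
noncomputable def zero : RatFun 0 R where
  A := 1
  B := 0
  natDegree_A_le := by simp
  coeff_A := by simp
  degree_B_lt := by simp
  isUnit_res := by simp

theorem zero_A : (zero : RatFun 0 R).A = 1 := rfl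
theorem zero_B : (zero : RatFun 0 R).B = 0 := rfl

theorem zero_V : (zero : RatFun 0 R).V = 0 := by
  have := (zero : RatFun 0 R).isBezout.degree_V_lt
  rw [← degree_eq_bot]
  simpa using! (Nat.WithBot.lt_zero_iff.1 this)

theorem zero_U : (zero : RatFun 0 R).U = 1 := by
  have := (zero : RatFun 0 R).isBezout.rel
  rwa [zero_A, zero_B, one_mul, zero_mul, add_zero] at this

theorem map_add (φ : R →+* S) (f : RatFun n R) (g : RatFun m R) :
    (f.add g).map φ = (f.map φ).add (g.map φ) := by
  ext1
  · simp [map, add_A, ← V_map]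
  · simp [map, add_B, ← U_map]

theorem map_map {T : Type u} [CommRing T] (φ : R →+* S) (ψ : S →+* T) (f : RatFun n R) :
    (f.map φ).map ψ = f.map (ψ.comp φ) := by
  ext1 <;> simp [map, Polynomial.map_map]

theorem map_id (f : RatFun n R) : f.map (RingHom.id R) = f := by
  ext1 <;> simp [map]

/-- The constant homotopy at `f`. -/
noncomputable def const (f : RatFun n R) : RatFun n R[X] := f.map C

/-- Evaluation of a pointed rational function over `R[T]` at `T = t`. -/
noncomputable def evalAt (t : R) (F : RatFun n R[X]) : RatFun n R := F.map (evalRingHom t)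

theorem evalAt_const (t : R) (f : RatFun n R) : f.const.evalAt t = f := by
  have : (evalRingHom t).comp C = RingHom.id R := by ext; simp
  rw [evalAt, const, map_map, this, map_id]

/-- `(π₀ᴺ 𝓕ₙ)(R)`: the naive connected components of `𝓕ₙ`. -/
def Pi0 (R : Type u) [CommRing R] (n : ℕ) : Type u :=
  NaivePi0 (evalAt (n := n) (0 : R)) (evalAt (n := n) (1 : R))

/-- The class of a pointed rational function in `(π₀ᴺ 𝓕ₙ)(R)`. -/
def toPi0 (f : RatFun n R) : Pi0 R n := Quot.mk _ f

theorem toPi0_evalAt (F : RatFun n R[X]) : (F.evalAt 0).toPi0 = (F.evalAt 1).toPi0 :=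
  Quot.sound ⟨F, rfl, rfl⟩

/-- The law induced by `⊕ᴺ` on naive connected components. -/
noncomputable def Pi0.add : Pi0 R n → Pi0 R m → Pi0 R (n + m) :=
  Quot.lift₂ (fun f g => (RatFun.add f g).toPi0)
    (by
      rintro f _ _ ⟨H, rfl, rfl⟩
      have := toPi0_evalAt (f.const.add H)
      rwa [evalAt, evalAt, map_add, map_add, ← evalAt, ← evalAt, ← evalAt, ← evalAt,
        evalAt_const, evalAt_const] at this)
    (by
      rintro _ _ g ⟨H, rfl, rfl⟩
      have := toPi0_evalAt (H.add g.const)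
      rwa [evalAt, evalAt, map_add, map_add, ← evalAt, ← evalAt, ← evalAt, ← evalAt,
        evalAt_const, evalAt_const] at this)

theorem mk_toPi0_eq {f : RatFun n R} {g : RatFun m R} (h : n = m) (hA : f.A = g.A)
    (hB : f.B = g.B) :
    (GradedMonoid.mk n f.toPi0 : GradedMonoid (Pi0 R)) = GradedMonoid.mk m g.toPi0 := by
  subst h
  rw [RatFun.ext hA hB]

/-- The unit is the class of `1 / 0`. -/
noncomputable instance : GradedMonoid.GOne (Pi0 R) where
  one := (zero : RatFun 0 R).toPi0

/-- The graded law (`*` in the notation of `GradedMonoid`) is `⊕ᴺ`. -/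
noncomputable instance : GradedMonoid.GMul (Pi0 R) where
  mul := Pi0.add

/-- The graded monoid `(∐ₙ (π₀ᴺ 𝓕ₙ)(R), ⊕ᴺ)`. -/
noncomputable instance : GradedMonoid.GMonoid (Pi0 R) where
  one_mul := by
    rintro ⟨n, ⟨f⟩⟩
    refine mk_toPi0_eq (f := zero.add f) (g := f) (zero_add n) ?_ ?_
    · rw [add_A, zero_A, zero_V]; ring
    · rw [add_B, zero_B, zero_U]; ring
  mul_one := by
    rintro ⟨n, ⟨f⟩⟩
    refine mk_toPi0_eq (f := f.add zero) (g := f) (add_zero n) ?_ ?_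
    · rw [add_A, zero_A, zero_B]; ring
    · rw [add_B, zero_A, zero_B]; ring
  mul_assoc := by
    rintro ⟨n, ⟨f⟩⟩ ⟨m, ⟨g⟩⟩ ⟨p, ⟨h⟩⟩
    refine mk_toPi0_eq (f := (f.add g).add h) (g := f.add (g.add h)) (add_assoc n m p) ?_ ?_
    · simp only [add_A, add_B, (add_UV f g).2]; ring
    · simp only [add_A, add_B, (add_UV f g).1]; ring

end RatFun

/-! ### Non-degenerate symmetric matrices -/

/-- An `R`-point of the scheme `𝓢ₙ` of non-degenerate symmetric `n × n` matrices. -/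
@[ext]
structure SymMat (n : ℕ) (R : Type u) [CommRing R] where
  M : Matrix (Fin n) (Fin n) R
  isSymm : M.IsSymm
  isUnit_det : IsUnit M.det

namespace SymMat

variable {R : Type u} [CommRing R] {S : Type u} [CommRing S] {n m p : ℕ}

/-- Functoriality of `𝓢ₙ` in the ring. -/
def map (φ : R →+* S) (a : SymMat n R) : SymMat n S where
  M := a.M.map φ
  isSymm := a.isSymm.map φ
  isUnit_det := by
    have := a.isUnit_det.map φ
    rwa [RingHom.map_det] at this

/-- The orthogonal sum, i.e. the block diagonal matrix with blocks `a` and `b`. -/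
def add (a : SymMat n R) (b : SymMat m R) : SymMat (n + m) R where
  M := Matrix.reindex finSumFinEquiv finSumFinEquiv (Matrix.fromBlocks a.M 0 0 b.M)
  isSymm := by
    have : (Matrix.fromBlocks a.M 0 0 b.M).IsSymm :=
      Matrix.IsSymm.fromBlocks a.isSymm (by simp) b.isSymm
    rw [Matrix.reindex_apply]
    exact this.submatrix _
  isUnit_det := by
    rw [Matrix.det_reindex_self, Matrix.det_fromBlocks_zero₂₁]
    exact a.isUnit_det.mul b.isUnit_det

/-- The unique `0 × 0` matrix. -/
def zero : SymMat 0 R where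
  M := 0
  isSymm := Matrix.isSymm_zero
  isUnit_det := by simp

theorem map_add (φ : R →+* S) (a : SymMat n R) (b : SymMat m R) :
    (a.add b).map φ = (a.map φ).add (b.map φ) := by
  ext1
  simp only [map, add, Matrix.reindex_apply, ← Matrix.submatrix_map, Matrix.fromBlocks_map]
  simp

theorem map_map {T : Type u} [CommRing T] (φ : R →+* S) (ψ : S →+* T) (a : SymMat n R) :
    (a.map φ).map ψ = a.map (ψ.comp φ) := by
  ext1; ext i j; simp [map]

theorem map_id (a : SymMat n R) : a.map (RingHom.id R) = a := by
  ext1; ext i j; simp [map]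

/-- The constant homotopy at `a`. -/
noncomputable def const (a : SymMat n R) : SymMat n R[X] := a.map C

/-- Evaluation of a symmetric matrix over `R[T]` at `T = t`. -/
noncomputable def evalAt (t : R) (F : SymMat n R[X]) : SymMat n R := F.map (evalRingHom t)

theorem evalAt_const (t : R) (a : SymMat n R) : a.const.evalAt t = a := by
  have : (evalRingHom t).comp C = RingHom.id R := by ext; simp
  rw [evalAt, const, map_map, this, map_id]

/-- `(π₀ᴺ 𝓢ₙ)(R)`: the naive connected components of `𝓢ₙ`. -/
def Pi0 (R : Type u) [CommRing R] (n : ℕ) : Type u :=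
  NaivePi0 (evalAt (n := n) (0 : R)) (evalAt (n := n) (1 : R))

/-- The class of a non-degenerate symmetric matrix in `(π₀ᴺ 𝓢ₙ)(R)`. -/
def toPi0 (a : SymMat n R) : Pi0 R n := Quot.mk _ a

theorem toPi0_evalAt (F : SymMat n R[X]) : (F.evalAt 0).toPi0 = (F.evalAt 1).toPi0 :=
  Quot.sound ⟨F, rfl, rfl⟩

/-- The law induced by the orthogonal sum on naive connected components. -/
def Pi0.add : Pi0 R n → Pi0 R m → Pi0 R (n + m) :=
  Quot.lift₂ (fun a b => (SymMat.add a b).toPi0)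
    (by
      rintro f _ _ ⟨H, rfl, rfl⟩
      have := toPi0_evalAt (f.const.add H)
      rwa [evalAt, evalAt, map_add, map_add, ← evalAt, ← evalAt, ← evalAt, ← evalAt,
        evalAt_const, evalAt_const] at this)
    (by
      rintro _ _ g ⟨H, rfl, rfl⟩
      have := toPi0_evalAt (H.add g.const)
      rwa [evalAt, evalAt, map_add, map_add, ← evalAt, ← evalAt, ← evalAt, ← evalAt,
        evalAt_const, evalAt_const] at this)

theorem mk_toPi0_eq {a : SymMat n R} {b : SymMat m R} (h : n = m)
    (hM : ∀ i j, a.M i j = b.M (Fin.cast h i) (Fin.cast h j)) :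
    (GradedMonoid.mk n a.toPi0 : GradedMonoid (Pi0 R)) = GradedMonoid.mk m b.toPi0 := by
  subst h
  have : a = b := by
    ext i j
    exact hM i j
  rw [this]

theorem add_M_natAdd_natAdd (a : SymMat n R) (b : SymMat m R) (i j : Fin m) :
    (a.add b).M (Fin.natAdd n i) (Fin.natAdd n j) = b.M i j := by simp [add]

theorem add_M_castAdd_castAdd (a : SymMat n R) (b : SymMat m R) (i j : Fin n) :
    (a.add b).M (Fin.castAdd m i) (Fin.castAdd m j) = a.M i j := by simp [add]

theorem add_M_castAdd_natAdd (a : SymMat n R) (b : SymMat m R) (i : Fin n) (j : Fin m) :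
    (a.add b).M (Fin.castAdd m i) (Fin.natAdd n j) = 0 := by simp [add]

theorem add_M_natAdd_castAdd (a : SymMat n R) (b : SymMat m R) (i : Fin m) (j : Fin n) :
    (a.add b).M (Fin.natAdd n i) (Fin.castAdd m j) = 0 := by simp [add]

/-- The unit is the class of the `0 × 0` matrix. -/
instance : GradedMonoid.GOne (Pi0 R) where
  one := (zero : SymMat 0 R).toPi0

/-- The graded law (`*` in the notation of `GradedMonoid`) is the orthogonal sum. -/
instance : GradedMonoid.GMul (Pi0 R) where
  mul := Pi0.add

/-- The graded monoid `(∐ₙ (π₀ᴺ 𝓢ₙ)(R), ⊕)`. -/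
instance : GradedMonoid.GMonoid (Pi0 R) where
  one_mul := by
    rintro ⟨n, ⟨a⟩⟩
    refine mk_toPi0_eq (a := zero.add a) (b := a) (zero_add n) fun i j => ?_
    induction i using Fin.addCases with
    | left i => exact i.elim0
    | right i =>
      induction j using Fin.addCases with
      | left j => exact j.elim0
      | right j => rw [add_M_natAdd_natAdd]; congr 1 <;> ext <;> simp
  mul_one := by
    rintro ⟨n, ⟨a⟩⟩
    refine mk_toPi0_eq (a := a.add zero) (b := a) (add_zero n) fun i j => ?_
    induction i using Fin.addCases with
    | right i => exact i.elim0
    | left i =>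
      induction j using Fin.addCases with
      | right j => exact j.elim0
      | left j => rw [add_M_castAdd_castAdd]; congr 1
  mul_assoc := by
    rintro ⟨n, ⟨a⟩⟩ ⟨m, ⟨b⟩⟩ ⟨p, ⟨c⟩⟩
    refine mk_toPi0_eq (a := (a.add b).add c) (b := a.add (b.add c)) (add_assoc n m p)
      fun i j => ?_
    have e1 : ∀ i : Fin n, Fin.cast (add_assoc n m p) (Fin.castAdd p (Fin.castAdd m i)) =
        Fin.castAdd (m + p) i := fun i => by ext; simp
    have e2 : ∀ i : Fin m, Fin.cast (add_assoc n m p) (Fin.castAdd p (Fin.natAdd n i)) =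
        Fin.natAdd n (Fin.castAdd p i) := fun i => by ext; simp
    have e3 : ∀ i : Fin p, Fin.cast (add_assoc n m p) (Fin.natAdd (n + m) i) =
        Fin.natAdd n (Fin.natAdd m i) := fun i => by ext; simp [add_assoc]
    have split : ∀ i : Fin (n + m + p), (∃ a : Fin n, i = Fin.castAdd p (Fin.castAdd m a)) ∨
        (∃ a : Fin m, i = Fin.castAdd p (Fin.natAdd n a)) ∨
        (∃ a : Fin p, i = Fin.natAdd (n + m) a) := by
      intro i
      induction i using Fin.addCases with
      | left i =>
        induction i using Fin.addCases with
        | left i => exact Or.inl ⟨i, rfl⟩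
        | right i => exact Or.inr (Or.inl ⟨i, rfl⟩)
      | right i => exact Or.inr (Or.inr ⟨i, rfl⟩)
    rcases split i with ⟨i, rfl⟩ | ⟨i, rfl⟩ | ⟨i, rfl⟩ <;>
      rcases split j with ⟨j, rfl⟩ | ⟨j, rfl⟩ | ⟨j, rfl⟩ <;>
      simp only [e1, e2, e3, add_M_natAdd_natAdd, add_M_castAdd_castAdd,
        add_M_castAdd_natAdd, add_M_natAdd_castAdd]

end SymMat

/-! ### The Bézout form -/

section Bezout

variable {R : Type u} [CommRing R] {S : Type u} [CommRing S] {n : ℕ}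

/-- `A(X) B(Y) - A(Y) B(X)`, in `R[Y][X]`: the outer variable is `X`, the inner one is `Y`. -/
noncomputable def bezNum (A B : R[X]) : R[X][X] := A.map C * C B - C A * B.map C

/-- `δ_{A,B}(X, Y) = (A(X) B(Y) - A(Y) B(X)) / (X - Y)`, in `R[Y][X]`. -/
noncomputable def bezPoly (A B : R[X]) : R[X][X] := bezNum A B /ₘ (X - C X)

/-- The matrix of coefficients of `δ_{A,B}`: the entry in row `p` and column `q`, counted from
`0`, is the coefficient of `X ^ p * Y ^ q`. -/
noncomputable def bezMatrix (n : ℕ) (A B : R[X]) : Matrix (Fin n) (Fin n) R :=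
  Matrix.of fun p q => ((bezPoly A B).coeff p).coeff q

/-- The division defining `δ_{A,B}` is exact. -/
theorem X_sub_Y_mul_bezPoly (A B : R[X]) : (X - C X) * bezPoly A B = bezNum A B := by
  rw [bezPoly, mul_divByMonic_eq_iff_isRoot]
  simp [bezNum, IsRoot.def, eval_map, eval₂_C_X, mul_comm]

theorem coeff_swap (P : R[X][X]) (i j : ℕ) :
    ((Bivariate.swap P).coeff i).coeff j = (P.coeff j).coeff i := by
  induction P using Polynomial.induction_on' with
  | add P Q hP hQ => simp only [_root_.map_add, coeff_add, hP, hQ]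
  | monomial a f =>
    induction f using Polynomial.induction_on' with
    | add f g hf hg => simp only [_root_.map_add, coeff_add, hf, hg]
    | monomial b r =>
      rw [Bivariate.swap_monomial_monomial]
      simp only [coeff_monomial]
      split_ifs <;> simp_all [coeff_monomial]

theorem swap_bezPoly (A B : R[X]) : Bivariate.swap (bezPoly A B) = bezPoly A B := by
  have h := congrArg (Bivariate.swap (R := R)) (X_sub_Y_mul_bezPoly A B)
  rw [map_mul, map_sub, Bivariate.swap_X, Bivariate.swap_Y] at h
  have h2 : Bivariate.swap (bezNum A B) = - bezNum A B := by
    simp only [bezNum, map_sub, map_mul, Bivariate.swap_map_C, Bivariate.swap_C]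
    ring
  rw [h2, ← X_sub_Y_mul_bezPoly] at h
  apply (monic_X_sub_C (X : R[X])).isRegular.left
  show (X - C X) * _ = (X - C X) * _
  linear_combination -h

theorem bezPoly_coeff_symm (A B : R[X]) (i j : ℕ) :
    ((bezPoly A B).coeff i).coeff j = ((bezPoly A B).coeff j).coeff i := by
  rw [← coeff_swap, swap_bezPoly]

theorem bezNum_map (φ : R →+* S) (A B : R[X]) :
    (bezNum A B).map (mapRingHom φ) = bezNum (A.map φ) (B.map φ) := by
  have : (mapRingHom φ).comp C = C.comp φ := by ext; simp
  simp [bezNum, Polynomial.map_map, this]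

theorem bezPoly_map (φ : R →+* S) (A B : R[X]) :
    (bezPoly A B).map (mapRingHom φ) = bezPoly (A.map φ) (B.map φ) := by
  rw [bezPoly, map_divByMonic _ (monic_X_sub_C _), bezNum_map, bezPoly]
  simp

theorem bezNum_coeff (A B : R[X]) (p : ℕ) :
    (bezNum A B).coeff p = C (A.coeff p) * B - A * C (B.coeff p) := by
  simp [bezNum]

theorem bezPoly_coeff_eq_zero (f : RatFun n R) (hn : 1 ≤ n) {p : ℕ} (hp : n ≤ p) :
    (bezPoly f.A f.B).coeff p = 0 := by
  nontriviality R
  apply coeff_eq_zero_of_natDegree_lt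
  rw [bezPoly, natDegree_divByMonic _ (monic_X_sub_C _), natDegree_X_sub_C]
  have : (bezNum f.A f.B).natDegree ≤ n := by
    rw [natDegree_le_iff_coeff_eq_zero]
    intro N hN
    rw [bezNum_coeff, coeff_eq_zero_of_natDegree_lt (f.natDegree_A_le.trans_lt hN),
      coeff_eq_zero_of_degree_lt (f.degree_B_lt.trans (by exact_mod_cast hN))]
    simp
  omega

theorem bezPoly_rec_succ (A B : R[X]) (p : ℕ) :
    (bezPoly A B).coeff p - X * (bezPoly A B).coeff (p + 1) =
      C (A.coeff (p + 1)) * B - A * C (B.coeff (p + 1)) := by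
  rw [← bezNum_coeff, ← X_sub_Y_mul_bezPoly, sub_mul, coeff_sub, coeff_X_mul, coeff_C_mul]

theorem bezPoly_rec_zero (A B : R[X]) :
    - (X * (bezPoly A B).coeff 0) = C (A.coeff 0) * B - A * C (B.coeff 0) := by
  rw [← bezNum_coeff, ← X_sub_Y_mul_bezPoly, sub_mul, coeff_sub, coeff_C_mul]
  simp

/-- The Bézout form of a pointed rational function is non-degenerate. -/
theorem isUnit_det_bezMatrix (f : RatFun n R) : IsUnit (bezMatrix n f.A f.B).det := by
  rcases subsingleton_or_nontrivial R with hR | hR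
  · exact isUnit_of_subsingleton _
  rcases Nat.eq_zero_or_pos n with rfl | hn
  · simp
  let d : ℕ → R[X] := fun p => (bezPoly f.A f.B).coeff p
  let N : Submodule R R[X] := Submodule.span R (Set.range fun p : Fin n => d p) ⊔
    (Ideal.span {f.A}).restrictScalars R
  have hA : ∀ Q, f.A * Q ∈ N := fun Q => Submodule.mem_sup_right
    (Submodule.restrictScalars_mem R _ _ |>.2 (Ideal.mem_span_singleton.2 ⟨Q, rfl⟩))
  have hd : ∀ p, d p ∈ N := fun p => by
    by_cases hp : p < n
    · exact Submodule.mem_sup_left (Submodule.subset_span ⟨⟨p, hp⟩, rfl⟩)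
    · have : d p = 0 := bezPoly_coeff_eq_zero f hn (not_lt.1 hp)
      rw [this]; exact N.zero_mem
  have hB : f.B ∈ N := by
    have h := bezPoly_rec_succ f.A f.B (n - 1)
    rw [Nat.sub_add_cancel hn, f.coeff_A, bezPoly_coeff_eq_zero f hn le_rfl,
      coeff_eq_zero_of_degree_lt f.degree_B_lt] at h
    have : f.B = d (n - 1) := by
      simp only [mul_zero, sub_zero, C_1, one_mul, C_0] at h
      exact h.symm
    rw [this]; exact hd _
  have hCB : ∀ a : R, C a * f.B ∈ N := fun a => by
    rw [← smul_eq_C_mul]; exact N.smul_mem _ hB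
  have hXd : ∀ p, X * d p ∈ N := by
    rintro (_ | p)
    · have h := bezPoly_rec_zero f.A f.B
      have : X * d 0 = f.A * C (f.B.coeff 0) - C (f.A.coeff 0) * f.B := by
        linear_combination -h
      rw [this]; exact N.sub_mem (hA _) (hCB _)
    · have h := bezPoly_rec_succ f.A f.B p
      have : X * d (p + 1) = d p - C (f.A.coeff (p + 1)) * f.B +
          f.A * C (f.B.coeff (p + 1)) := by
        linear_combination -h
      rw [this]; exact N.add_mem (N.sub_mem (hd _) (hCB _)) (hA _)
  have hX : ∀ P ∈ N, X * P ∈ N := by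
    intro P hP
    obtain ⟨y, hy, z, hz, rfl⟩ := Submodule.mem_sup.1 hP
    rw [mul_add]
    refine N.add_mem ?_ ?_
    · obtain ⟨w, rfl⟩ := (Submodule.mem_span_range_iff_exists_fun R).1 hy
      rw [Finset.mul_sum]
      refine N.sum_mem fun p _ => ?_
      rw [mul_smul_comm]
      exact N.smul_mem _ (hXd p)
    · obtain ⟨Q, rfl⟩ := Ideal.mem_span_singleton.1 (Submodule.restrictScalars_mem R _ _ |>.1 hz)
      rw [mul_left_comm]; exact hA _
  have hXn : ∀ q : ℕ, ∀ P ∈ N, X ^ q * P ∈ N := by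
    intro q
    induction q with
    | zero => intro P hP; simpa using hP
    | succ q ih => intro P hP; rw [pow_succ, mul_assoc]; exact ih _ (hX _ hP)
  have hmul : ∀ Q : R[X], Q * f.B ∈ N := by
    intro Q
    induction Q using Polynomial.induction_on' with
    | add P Q hP hQ => rw [add_mul]; exact N.add_mem hP hQ
    | monomial q a =>
      rw [← C_mul_X_pow_eq_monomial, mul_assoc, ← smul_eq_C_mul]
      exact N.smul_mem _ (hXn q _ hB)
  have hall : ∀ Q : R[X], Q ∈ N := fun Q => by
    have : Q = f.A * (f.U * Q) + (f.V * Q) * f.B := by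
      linear_combination -Q * f.isBezout.rel
    rw [this]; exact N.add_mem (hA _) (hmul _)
  have key : ∀ q : Fin n, ∃ w : Fin n → R, ∑ p, w p • d p = X ^ (q : ℕ) := by
    intro q
    obtain ⟨y, hy, z, hz, hyz⟩ := Submodule.mem_sup.1 (hall (X ^ (q : ℕ)))
    obtain ⟨w, rfl⟩ := (Submodule.mem_span_range_iff_exists_fun R).1 hy
    obtain ⟨Q, rfl⟩ := Ideal.mem_span_singleton.1 (Submodule.restrictScalars_mem R _ _ |>.1 hz)
    refine ⟨w, ?_⟩
    have hlt : (f.A * Q).degree < f.A.degree := by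
      rw [f.degree_A, degree_lt_iff_coeff_zero]
      intro j hj
      have h1 : f.A * Q = X ^ (q : ℕ) - ∑ p : Fin n, w p • d p := by rw [← hyz]; ring
      rw [h1, coeff_sub, coeff_X_pow, if_neg (by have := q.2; omega), finsetSum_coeff]
      rw [Finset.sum_eq_zero, sub_zero]
      intro p _
      have : (d p).coeff j = 0 := by
        show ((bezPoly f.A f.B).coeff p).coeff j = 0
        rw [bezPoly_coeff_symm, bezPoly_coeff_eq_zero f hn hj, coeff_zero]
      rw [coeff_smul, this, smul_zero]
    rw [degree_lt_of_monic_mul f.monic hlt, mul_zero, add_zero] at hyz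
    exact hyz
  choose w hw using key
  have hinv : Matrix.of w * bezMatrix n f.A f.B = 1 := by
    ext i j
    have := congrArg (fun P => P.coeff (j : ℕ)) (hw i)
    simp only [finsetSum_coeff, coeff_smul, smul_eq_mul, coeff_X_pow] at this
    rw [Matrix.mul_apply, Matrix.one_apply]
    simp only [Matrix.of_apply, bezMatrix]
    refine this.trans ?_
    simp only [Fin.ext_iff, eq_comm]
  exact Matrix.isUnit_det_of_left_inverse hinv

/-- The Bézout form, as a map `𝓕ₙ(R) → 𝓢ₙ(R)`. -/
noncomputable def RatFun.bez (f : RatFun n R) : SymMat n R where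
  M := bezMatrix n f.A f.B
  isSymm := by
    ext i j
    exact bezPoly_coeff_symm _ _ _ _
  isUnit_det := isUnit_det_bezMatrix f

/-- The Bézout form is a natural transformation. -/
theorem RatFun.bez_map (φ : R →+* S) (f : RatFun n R) : (f.map φ).bez = f.bez.map φ := by
  ext i j
  simp only [bez, bezMatrix, SymMat.map, Matrix.of_apply, Matrix.map_apply, map]
  rw [← bezPoly_map]
  simp

/-- The map `π₀ᴺ Bézₙ : (π₀ᴺ 𝓕ₙ)(R) → (π₀ᴺ 𝓢ₙ)(R)` induced by the Bézout form. -/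
noncomputable def pi0Bez (R : Type u) [CommRing R] (n : ℕ) :
    RatFun.Pi0 R n → SymMat.Pi0 R n :=
  Quot.lift (fun f => f.bez.toPi0) (by
    rintro _ _ ⟨H, rfl, rfl⟩
    rw [RatFun.evalAt, RatFun.evalAt, RatFun.bez_map, RatFun.bez_map]
    exact SymMat.toPi0_evalAt H.bez)

end Bezout

end NaiveP1

/-! Both monoids are generated in rank one: by the forms ⟨u⟩ and by the functions X/u. For
functions, division with remainder splits A/B into summands P/b with constant denominator, and
homotopies reduce these to X/u. For forms, a homotopy makes the first diagonal entry nonzero and an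
orthogonal line splits off, in characteristic 2 as well. The Bézout polynomial of X/u ⊕ A/B is u
A(X) A(Y) plus that of A/B, so its matrix is unipotently congruent to Béz(A/B) ⊕ ⟨u⟩. Hence Béz is a
surjective homomorphism.

For injectivity, the point is that all relations between the ⟨u⟩ come from rank two, where Béz has a
polynomial section (`RatFun.ofSymMat`) that carries them over to the X/u. Let `g` be any map from
`k` to a commutative monoid that respects the rank two relations (`IsBinaryLaw`). An orthogonal
decomposition of a form into lines and hyperbolic planes has a discriminant δ in `k` and a class x,
the product of the values of `g`. Homotopies preserve determinants exactly, because units of `k[T]`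
are constant; so δ is recorded exactly and not modulo squares.

Two theorems make the set of pairs (δ, x) an invariant of naive components. Over a field,
`OrthVal.unique` is Witt's chain equivalence with discriminants: δ is unique up to squares and
determines x. Over `k[T]`, Hermite reduction (`exists_basis_hermite_bound`) shows that a nonzero
unimodular form has a vector of constant nonzero value or contains a hyperbolic plane; splitting
these off gives all specializations a common pair (`UnimodularOn.exists_orthVal`). Now let `g u` be
the class of X/u in the monoid of functions itself. The pair (det Béz(x), x) occurs among the
decompositions of Béz(x), so the image of x determines x. -/

namespace NaiveP1

/-! ### Orthogonal decompositions of symmetric bilinear forms over a field -/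

section Perp

variable {R V : Type*} [CommRing R] [AddCommGroup V] [Module R V]

/-- The vectors of `W` that are orthogonal to `v`. -/
def perp (B : LinearMap.BilinForm R V) (W : Submodule R V) (v : V) : Submodule R V :=
  W ⊓ LinearMap.ker (B v)

variable {B : LinearMap.BilinForm R V} {W : Submodule R V}

theorem mem_perp {v w : V} : w ∈ perp B W v ↔ w ∈ W ∧ B v w = 0 := by
  simp [perp]

theorem perp_le (B : LinearMap.BilinForm R V) (W : Submodule R V) (v : V) : perp B W v ≤ W :=
  inf_le_left

theorem perp_lt {v w : V} (hw : w ∈ W) (h : B v w ≠ 0) : perp B W v < W :=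
  lt_of_le_of_ne (perp_le B W v) fun e => h (mem_perp.1 (e.ge hw)).2

end Perp

section OrthDecomp

variable {k V M : Type*} [Field k] [AddCommGroup V] [Module k V] [CommMonoid M]

/-- The relations between the classes `g u` of the forms of rank one that come from rank two. -/
structure IsBinaryLaw (g : k → M) : Prop where
  binary : ∀ a b x y : k, a ≠ 0 → b ≠ 0 → a * x ^ 2 + b * y ^ 2 ≠ 0 →
    g a * g b = g (a * x ^ 2 + b * y ^ 2) * g (a * b / (a * x ^ 2 + b * y ^ 2))
  -- The two sides diagonalize [0, c; c, d] and [0, c; c, 1]. If 2 ≠ 0 this follows from `binary`,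
  -- since a hyperbolic plane represents 1; in characteristic 2 it is a separate relation.
  hyperbolic : ∀ c d : k, c ≠ 0 → d ≠ 0 → g d * g (-c ^ 2 / d) = g 1 * g (-c ^ 2)

/-- The class of a hyperbolic plane with Gram matrix `[0, c; c, d]`. -/
def hypClass (g : k → M) (c : k) : M := g 1 * g (-c ^ 2)

/-- `OrthVal B g W δ x`: the space `W` has an orthogonal decomposition into anisotropic lines and
hyperbolic planes, with discriminant `δ`, whose summands have classes with product `x`. -/
inductive OrthVal (B : LinearMap.BilinForm k V) (g : k → M) : Submodule k V → k → M → Prop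
  | bot : OrthVal B g ⊥ 1 1
  | line {W : Submodule k V} {v : V} {δ : k} {x : M} (hv : v ∈ W) (h : B v v ≠ 0)
      (H : OrthVal B g (perp B W v) δ x) : OrthVal B g W (B v v * δ) (g (B v v) * x)
  | plane {W : Submodule k V} {r z : V} {δ : k} {x : M} (hr : r ∈ W) (hz : z ∈ W)
      (h0 : B r r = 0) (h : B r z ≠ 0) (H : OrthVal B g (perp B (perp B W r) z) δ x) :
      OrthVal B g W (-B r z ^ 2 * δ) (hypClass g (B r z) * x)

/-- The restriction of `B` to `W` is non-degenerate. -/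
def NondegOn (B : LinearMap.BilinForm k V) (W : Submodule k V) : Prop :=
  ∀ v ∈ W, (∀ w ∈ W, B v w = 0) → v = 0

variable {B : LinearMap.BilinForm k V} {g : k → M} {W : Submodule k V}

theorem perp_smul {v : V} {c : k} (hc : c ≠ 0) : perp B W (c • v) = perp B W v := by
  ext w; simp [mem_perp, hc]

theorem perp_comm (v w : V) : perp B (perp B W v) w = perp B (perp B W w) v := by
  ext; simp only [mem_perp]; tauto

theorem NondegOn.perp_line (hB : ∀ x y, B x y = B y x) (hW : NondegOn B W) {v : V} (hv : v ∈ W)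
    (h : B v v ≠ 0) : NondegOn B (perp B W v) := by
  intro u hu hu'
  rw [mem_perp] at hu
  refine hW u hu.1 fun w hw => ?_
  have := hu' (w - (B v w / B v v) • v) (mem_perp.2
    ⟨W.sub_mem hw (W.smul_mem _ hv), by simp [h]⟩)
  simpa [hB u v, hu.2] using this

theorem NondegOn.perp_plane (hB : ∀ x y, B x y = B y x) (hW : NondegOn B W) {r z : V}
    (hr : r ∈ W) (hz : z ∈ W) (h0 : B r r = 0) (h : B r z ≠ 0) :
    NondegOn B (perp B (perp B W r) z) := by
  intro u hu hu'
  simp only [mem_perp] at hu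
  refine hW u hu.1.1 fun w hw => ?_
  have := hu' (w - (B r w / B r z) • z - ((B z w - (B r w / B r z) * B z z) / B r z) • r) (by
    simp only [mem_perp]
    refine ⟨⟨W.sub_mem (W.sub_mem hw (W.smul_mem _ hz)) (W.smul_mem _ hr), ?_⟩, ?_⟩
    · simp [h0, h]
    · simp [hB z r, h])
  simpa [hB u r, hB u z, hu.2, hu.1.2] using this

theorem OrthVal.nondegOn (hB : ∀ x y, B x y = B y x) {δ : k} {x : M} (H : OrthVal B g W δ x) :
    NondegOn B W := by
  induction H with
  | bot => intro v hv _; simpa using hv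
  | line hv h _ ih =>
    intro u hu hu'
    exact ih u (mem_perp.2 ⟨hu, by rw [hB]; exact hu' _ hv⟩)
      fun w hw => hu' w (mem_perp.1 hw).1
  | plane hr hz h0 h _ ih =>
    intro u hu hu'
    exact ih u (mem_perp.2 ⟨mem_perp.2 ⟨hu, by rw [hB]; exact hu' _ hr⟩,
      by rw [hB]; exact hu' _ hz⟩) fun w hw => hu' w (mem_perp.1 (mem_perp.1 hw).1).1

theorem OrthVal.ne_zero {δ : k} {x : M} (H : OrthVal B g W δ x) : δ ≠ 0 := by
  induction H with
  | bot => exact one_ne_zero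
  | line hv h _ ih => exact mul_ne_zero h ih
  | plane hr hz h0 h _ ih => exact mul_ne_zero (neg_ne_zero.2 (pow_ne_zero _ h)) ih

/-- Without anisotropic vectors every r ≠ 0 is isotropic, and non-degeneracy supplies a partner z
spanning a hyperbolic plane with it. The complement is smaller and again non-degenerate. -/
theorem NondegOn.exists_orthVal [FiniteDimensional k V] (hB : ∀ x y, B x y = B y x) (g : k → M)
    (hW : NondegOn B W) : ∃ δ x, OrthVal B g W δ x := by
  induction W using WellFoundedLT.induction with
  | _ W ih =>
  by_cases hq : ∃ v ∈ W, B v v ≠ 0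
  · obtain ⟨v, hv, h⟩ := hq
    obtain ⟨δ, x, H⟩ := ih _ (perp_lt hv h) (hW.perp_line hB hv h)
    exact ⟨_, _, H.line hv h⟩
  push Not at hq
  by_cases h0 : W = ⊥
  · subst h0; exact ⟨_, _, OrthVal.bot⟩
  obtain ⟨r, hr, hr0⟩ := (Submodule.ne_bot_iff W).1 h0
  obtain ⟨z, hz, h⟩ : ∃ z ∈ W, B r z ≠ 0 := by
    by_contra! hc
    exact hr0 (hW r hr hc)
  obtain ⟨δ, x, H⟩ := ih _ ((perp_le B _ z).trans_lt (perp_lt hz h))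
    (hW.perp_plane hB hr hz (hq r hr) h)
  exact ⟨_, _, H.plane hr hz (hq r hr) h⟩

/-- The form ⟨a, c²b⟩ takes the value c²a at (c, 0), and its determinant then leaves b as the second
entry. Squares can thus move between factors, although `g` itself need not be invariant under them.
-/
theorem IsBinaryLaw.scale (hg : IsBinaryLaw g) {a b c : k} (ha : a ≠ 0) (hb : b ≠ 0)
    (hc : c ≠ 0) : g (c ^ 2 * a) * g b = g a * g (c ^ 2 * b) := by
  have := hg.binary a (c ^ 2 * b) c 0 ha (by positivity) (by simp [ha, hc])
  rw [this]
  congr 2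
  · ring
  · rw [zero_pow two_ne_zero, mul_zero, add_zero]; field_simp

theorem IsBinaryLaw.scale_hypClass (hg : IsBinaryLaw g) {a b c : k} (ha : a ≠ 0) (hb : b ≠ 0)
    (hc : c ≠ 0) : g (c ^ 2 * a) * hypClass g b = g a * hypClass g (c * b) := by
  rw [hypClass, mul_left_comm, hg.scale ha (neg_ne_zero.2 (pow_ne_zero 2 hb)) hc, hypClass,
    mul_left_comm (g a)]
  congr 3; ring

/-- Each plane contributes a factor `g (-c ^ 2)`, and the square a² moves from one such factor to
the other. -/
theorem IsBinaryLaw.hypClass_mul (hg : IsBinaryLaw g) {a b : k} (ha : a ≠ 0) (hb : b ≠ 0) :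
    hypClass g a * hypClass g b = hypClass g 1 * hypClass g (a * b) := by
  have := hg.scale_hypClass (neg_ne_zero.2 (one_ne_zero (α := k))) hb ha
  rw [hypClass, mul_assoc, show -a ^ 2 = a ^ 2 * -1 by ring, this]
  simp only [hypClass, one_pow, mul_assoc]

theorem hypClass_congr {a b : k} (h : a ^ 2 = b ^ 2) : hypClass g a = hypClass g b := by
  rw [hypClass, hypClass, h]

/-- The first vector of the decomposition is multiplied by c. An additional rank one factor absorbs
the square, and the zero space is excluded because it has no vector to rescale. -/
theorem OrthVal.scale (hg : IsBinaryLaw g) {δ : k} {x : M} (H : OrthVal B g W δ x) (hW : W ≠ ⊥)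
    {c : k} (hc : c ≠ 0) :
    ∃ x', OrthVal B g W (c ^ 2 * δ) x' ∧ ∀ a ≠ 0, g (c ^ 2 * a) * x = g a * x' := by
  cases H with
  | bot => exact absurd rfl hW
  | @line _ v δ x hv h H =>
    rw [← perp_smul hc] at H
    have h' : B (c • v) (c • v) = c ^ 2 * B v v := by simp; ring
    have H' := H.line (W.smul_mem c hv) (by rw [h']; positivity)
    rw [h', mul_assoc] at H'
    refine ⟨_, H', fun a ha => ?_⟩
    rw [← mul_assoc, ← mul_assoc, hg.scale ha h hc]
  | @plane _ r z δ x hr hz h0 h H =>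
    rw [← perp_smul (v := r) hc] at H
    have h' : B (c • r) z = c * B r z := by simp
    have H' := H.plane (W.smul_mem c hr) hz (by simp [h0]) (by rw [h']; positivity)
    rw [h'] at H'
    refine ⟨hypClass g (c * B r z) * x, by convert H' using 1; ring, fun a ha => ?_⟩
    rw [← mul_assoc, ← mul_assoc, hg.scale_hypClass ha h hc]

theorem OrthVal.of_bot {δ : k} {x : M} (H : OrthVal B g ⊥ δ x) : δ = 1 ∧ x = 1 := by
  generalize hW : (⊥ : Submodule k V) = W at H
  cases H with
  | bot => exact ⟨rfl, rfl⟩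
  | line hv h _ =>
    subst hW
    rw [Submodule.mem_bot] at hv
    simp [hv] at h
  | plane hr _ _ h _ =>
    subst hW
    rw [Submodule.mem_bot] at hr
    simp [hr] at h

theorem finrank_perp [FiniteDimensional k V] {v w : V} (hw : w ∈ W) (h : B v w ≠ 0) :
    Module.finrank k (perp B W v) + 1 = Module.finrank k W := by
  have hne : (B v).domRestrict W ≠ 0 := fun e => h (by
    simpa using congrArg (fun f => f ⟨w, hw⟩) e)
  rw [← Module.Dual.finrank_ker_add_one_of_ne_zero hne]
  have e : perp B W v = ((B v).domRestrict W).ker.map W.subtype := by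
    ext u
    simp [mem_perp, and_comm]
  rw [e, Submodule.finrank_map_subtype_eq]

/-- Only planes can occur, and `IsBinaryLaw.hypClass_mul` gathers their constants into the last one.
The dimension gives the number of planes and δ then gives s², on which alone the class depends. -/
theorem OrthVal.eq_of_isotropic [FiniteDimensional k V] (hB : ∀ x y, B x y = B y x)
    (hg : IsBinaryLaw g) {δ : k} {x : M}
    (H : OrthVal B g W δ x) (hq : ∀ v ∈ W, B v v = 0) :
    (W = ⊥ ∧ δ = 1 ∧ x = 1) ∨ ∃ (m : ℕ) (s : k), s ≠ 0 ∧ Module.finrank k W = 2 * (m + 1) ∧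
      δ = (-1) ^ (m + 1) * s ^ 2 ∧ x = hypClass g 1 ^ m * hypClass g s := by
  induction H with
  | bot => exact Or.inl ⟨rfl, rfl, rfl⟩
  | line hv h _ _ => exact absurd (hq _ hv) h
  | @plane W r z δ x hr hz h0 h _ ih =>
    have hd1 := finrank_perp hz h
    have hd2 := finrank_perp (B := B) (W := perp B W r) (v := z) (w := r)
      (mem_perp.2 ⟨hr, h0⟩) (by rwa [hB])
    right
    rcases ih fun v hv => hq v (perp_le _ _ _ (perp_le _ _ _ hv)) with
      ⟨e, rfl, rfl⟩ | ⟨m, s, hs, hm, rfl, rfl⟩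
    · rw [e, finrank_bot] at hd2
      exact ⟨0, B r z, h, by omega, by ring, by simp⟩
    · refine ⟨m + 1, B r z * s, mul_ne_zero h hs, by omega, by ring, ?_⟩
      rw [mul_left_comm, hg.hypClass_mul h hs, pow_succ, mul_assoc]

/-- A decomposition of a space with an anisotropic vector can be modified so as to start with an
anisotropic line. -/
theorem OrthVal.exists_line [FiniteDimensional k V] (hB : ∀ x y, B x y = B y x)
    (hg : IsBinaryLaw g)
    (ih : ∀ U < W, ∀ δ δ' x x', OrthVal B g U δ x → OrthVal B g U δ' x' →
      (∃ c ≠ 0, δ' = c ^ 2 * δ) ∧ (δ = δ' → x = x'))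
    {δ : k} {x : M} (H : OrthVal B g W δ x) (hq : ∃ v ∈ W, B v v ≠ 0) :
    ∃ v ∈ W, B v v ≠ 0 ∧ ∃ δ₁ x₁, OrthVal B g (perp B W v) δ₁ x₁ ∧ δ = B v v * δ₁ ∧
      x = g (B v v) * x₁ := by
  cases H with
  | bot =>
    obtain ⟨v, hv, h⟩ := hq
    rw [Submodule.mem_bot] at hv
    simp [hv] at h
  | line hv h H => exact ⟨_, hv, h, _, _, H, rfl, rfl⟩
  | @plane _ r z δ x hr hz h0 h H =>
    -- an anisotropic vector `p` and a vector `p'` spanning the plane orthogonally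
    have split : ∀ p p' : V, p ∈ W → p' ∈ W → B p p ≠ 0 → B p p' = 0 →
        B p' p' = -B r z ^ 2 / B p p →
        perp B (perp B W p) p' = perp B (perp B W r) z →
        ∃ v ∈ W, B v v ≠ 0 ∧ ∃ δ₁ x₁, OrthVal B g (perp B W v) δ₁ x₁ ∧
          -B r z ^ 2 * δ = B v v * δ₁ ∧ hypClass g (B r z) * x = g (B v v) * x₁ := by
      intro p p' hp hp' hpp hpp' hp'' e
      rw [← e] at H
      have H' := H.line (mem_perp.2 ⟨hp', hpp'⟩) (by
        rw [hp'']; exact div_ne_zero (neg_ne_zero.2 (pow_ne_zero 2 h)) hpp)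
      refine ⟨p, hp, hpp, _, _, H', ?_, ?_⟩
      · rw [hp'']; field_simp
      · rw [hp'', ← mul_assoc, hg.hyperbolic _ _ h hpp, hypClass]
    have hzr := hB z r
    -- The plane contains an anisotropic vector unless `B z z = 0` and 2 = 0: take z, or r + z. In
    -- the exceptional case the plane is alternating, so an anisotropic vector must come from its
    -- complement.
    by_cases hzz : B z z = 0
    · by_cases h2 : (2 : k) = 0
      · obtain ⟨v, hv, hvv⟩ := hq
        -- The projection of v away from the plane. It changes the value of the form only by a
        -- multiple of 2, which is zero here.
        set u : V := v - (B r v / B r z) • z - (B z v / B r z) • r with hu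
        have huW : u ∈ W := W.sub_mem (W.sub_mem hv (W.smul_mem _ hz)) (W.smul_mem _ hr)
        have hru : B r u = 0 := by simp [hu, h0, h]
        have hzu : B z u = 0 := by simp [hu, hzz, hzr, h]
        have huu : B u u = B v v := by
          have : B u u = B v u := by
            calc B u u = B (v - (B r v / B r z) • z - (B z v / B r z) • r) u := by rw [← hu]
              _ = B v u := by
                simp only [map_sub, map_smul, LinearMap.sub_apply, LinearMap.smul_apply, hru, hzu,
                  smul_zero, sub_zero]
          rw [this, hu]
          simp only [map_sub, map_smul, smul_eq_mul, hB v z, hB v r]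
          linear_combination (-(B r v / B r z) * B z v) * h2
        have huU : u ∈ perp B (perp B W r) z := by simp [mem_perp, huW, hru, hzu]
        have huu0 : B u u ≠ 0 := by rwa [huu]
        have hlt : perp B (perp B W r) z < W := (perp_le B _ z).trans_lt (perp_lt hz h)
        -- The complement is decomposed anew, starting with u. The discriminants agree up to a
        -- square c²; replacing u by c u makes them equal, so by induction the classes agree too.
        -- The line and the plane are then interchanged.
        obtain ⟨τ, t, Ht⟩ := ((H.nondegOn hB).perp_line hB huU huu0).exists_orthVal hB g
        obtain ⟨⟨c, hc, rfl⟩, -⟩ := ih _ hlt _ _ _ _ (Ht.line huU huu0) H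
        have hcu : B (c • u) (c • u) = c ^ 2 * B u u := by simp; ring
        have hcu0 : B (c • u) (c • u) ≠ 0 := by rw [hcu]; positivity
        rw [← perp_smul hc] at Ht
        have hx := (ih _ hlt _ _ _ _ (Ht.line (Submodule.smul_mem _ c huU) hcu0) H).2
          (by rw [hcu]; ring)
        subst hx
        rw [perp_comm, perp_comm r] at Ht
        have Hr := Ht.plane (mem_perp.2 ⟨hr, by simp [hB u r, hru]⟩)
          (mem_perp.2 ⟨hz, by simp [hB u z, hzu]⟩) h0 h
        exact ⟨c • u, W.smul_mem c huW, hcu0, _, _, Hr, by rw [hcu]; ring, mul_left_comm _ _ _⟩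
      · have hp : B (r + z) (r + z) = 2 * B r z := by simp [h0, hzz, hzr]; ring
        have hp0 : B (r + z) (r + z) ≠ 0 := by rw [hp]; exact mul_ne_zero h2 h
        refine split (r + z) ((1 / 2 : k) • (r - z)) (W.add_mem hr hz)
          (W.smul_mem _ (W.sub_mem hr hz)) hp0 ?_ ?_ ?_
        · simp [h0, hzz, hzr]
        · rw [hp]; simp [h0, hzz, hzr]; field_simp; ring
        · ext w
          simp only [mem_perp, map_add, map_smul, map_sub, LinearMap.add_apply,
            LinearMap.smul_apply, LinearMap.sub_apply, smul_eq_mul]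
          constructor
          · rintro ⟨⟨hw, h1⟩, h3⟩
            have h4 : B r w - B z w = 0 := by
              rcases mul_eq_zero.1 h3 with h3 | h3
              · simp [h2] at h3
              · exact h3
            have h5 : 2 * B r w = 0 := by linear_combination h1 + h4
            have h6 : B r w = 0 := (mul_eq_zero.1 h5).resolve_left h2
            exact ⟨⟨hw, h6⟩, by linear_combination h6 - h4⟩
          · rintro ⟨⟨hw, h1⟩, h3⟩
            simp [hw, h1, h3]
    · refine split z (r - (B r z / B z z) • z) hz (W.sub_mem hr (W.smul_mem _ hz)) hzz ?_ ?_ ?_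
      · simp [hzr, hzz]
      · simp [hzr, h0]; field_simp; ring
      · ext w
        simp only [mem_perp, map_smul, map_sub, LinearMap.smul_apply, LinearMap.sub_apply,
          smul_eq_mul]
        constructor
        · rintro ⟨⟨hw, h1⟩, h3⟩
          simp [hw, h1] at h3 ⊢; exact h3
        · rintro ⟨⟨hw, h1⟩, h3⟩
          simp [hw, h1, h3]

/-- The discriminant of an orthogonal decomposition is well defined up to squares, and it
determines the product of the classes of the summands. -/
theorem OrthVal.unique [FiniteDimensional k V] (hB : ∀ x y, B x y = B y x) (hg : IsBinaryLaw g)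
    (W : Submodule k V) : ∀ δ δ' x x', OrthVal B g W δ x → OrthVal B g W δ' x' →
      (∃ c ≠ 0, δ' = c ^ 2 * δ) ∧ (δ = δ' → x = x') := by
  induction W using WellFoundedLT.induction with
  | _ W ih =>
  intro δ δ' x x' H H'
  by_cases hq : ∃ v ∈ W, B v v ≠ 0
  swap
  -- Alternating case: the normal forms have the same number of planes, so equal discriminants force
  -- equal s².
  · push Not at hq
    rcases H.eq_of_isotropic hB hg hq with ⟨e, rfl, rfl⟩ | ⟨m, s, hs, hm, rfl, rfl⟩
    · subst e
      obtain ⟨rfl, rfl⟩ := H'.of_bot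
      exact ⟨⟨1, one_ne_zero, by simp⟩, fun _ => rfl⟩
    · rcases H'.eq_of_isotropic hB hg hq with ⟨e, rfl, rfl⟩ | ⟨m', s', hs', hm', rfl, rfl⟩
      · rw [e, finrank_bot] at hm; omega
      obtain rfl : m = m' := by omega
      refine ⟨⟨s' / s, div_ne_zero hs' hs, by field_simp⟩, fun e => ?_⟩
      rw [hypClass_congr (mul_left_cancel₀ (pow_ne_zero _ (neg_ne_zero.2 one_ne_zero)) e)]
  -- Both decompositions may start with lines, spanned by v and w. They are compared through the
  -- span of v and w, according to whether the component r of w orthogonal to v is zero, isotropic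
  -- or anisotropic.
  obtain ⟨w, hw, hww, δ₂, x₂, H₂, rfl, rfl⟩ := H'.exists_line hB hg ih hq
  obtain ⟨v, hv, hvv, δ₁, x₁, H₁, rfl, rfl⟩ := H.exists_line hB hg ih hq
  have hltv := perp_lt hv hvv
  have hltw := perp_lt hw hww
  have hWn := H.nondegOn hB
  have hwv := hB w v
  set r : V := w - (B v w / B v v) • v with hr
  have hrW : r ∈ W := W.sub_mem hw (W.smul_mem _ hv)
  have hvr : B v r = 0 := by simp [hr, hvv]
  have hrr : B r r = B w w - B v w ^ 2 / B v v := by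
    simp [hr, hwv]; field_simp; ring
  by_cases hr0 : r = 0
  · set c := B v w / B v v with hc
    have hwc : w = c • v := sub_eq_zero.1 hr0
    have hc0 : c ≠ 0 := by
      rintro e; rw [e, zero_smul] at hwc; simp [hwc] at hww
    have hqw : B w w = c ^ 2 * B v v := by rw [hwc]; simp; ring
    have hperp : perp B W w = perp B W v := by rw [hwc, perp_smul hc0]
    rw [hperp] at H₂
    obtain ⟨⟨s, hs, rfl⟩, heq⟩ := ih _ hltv _ _ _ _ H₁ H₂
    refine ⟨⟨c * s, mul_ne_zero hc0 hs, by rw [hqw]; ring⟩, fun e => ?_⟩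
    rw [hqw] at e ⊢
    by_cases hb : perp B W v = ⊥
    · rw [hb] at H₁ H₂
      obtain ⟨rfl, rfl⟩ := H₁.of_bot
      obtain ⟨h1, rfl⟩ := H₂.of_bot
      rw [h1] at e
      rw [← mul_right_cancel₀ one_ne_zero e]
    -- Here w = c v: the square c² is moved from the first line into the common complement, where
    -- induction applies.
    · obtain ⟨y, Hy, hy⟩ := H₂.scale hg hb hc0
      rw [hy _ hvv]
      congr 1
      refine (ih _ hltv _ _ _ _ H₁ Hy).2 ?_
      exact mul_left_cancel₀ hvv (by linear_combination e)
  by_cases hrr0 : B r r = 0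
  · -- the plane spanned by `v` and `w` is degenerate
    have hvw : B v w ^ 2 = B v v * B w w := by
      rw [hrr] at hrr0; field_simp at hrr0; linear_combination -hrr0
    have hvw0 : B v w ≠ 0 := by
      intro e; rw [e] at hvw; simp [hvv, hww] at hvw
    obtain ⟨z, hz, hrz⟩ : ∃ z ∈ perp B W v, B r z ≠ 0 := by
      by_contra! hc
      exact hr0 (hWn.perp_line hB hv hvv r (mem_perp.2 ⟨hrW, hvr⟩) hc)
    obtain ⟨hzW, hvz⟩ := mem_perp.1 hz
    have hrv : r ∈ perp B W v := mem_perp.2 ⟨hrW, hvr⟩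
    obtain ⟨ε, u, Hu⟩ :=
      ((hWn.perp_line hB hv hvv).perp_plane hB hrv hz hrr0 hrz).exists_orthVal hB g
    -- The vector z is corrected along v to become orthogonal to w; its product with r is unchanged,
    -- as r is orthogonal to v. The planes (r, z) in v^⊥ and (r, z') in w^⊥ have the same
    -- complement.
    set z' : V := z - (B r z / B v w) • v with hz'
    have hwr : B w r = 0 := by
      simp only [hr, map_sub, map_smul, smul_eq_mul, hwv]
      field_simp; linear_combination -hvw
    have hwz : B w z = B r z := by simp [hr, hvz]
    have hrw : r ∈ perp B W w := mem_perp.2 ⟨hrW, hwr⟩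
    have hz'w : z' ∈ perp B W w :=
      mem_perp.2 ⟨W.sub_mem hzW (W.smul_mem _ hv), by simp [hz', hwz, hwv, hvw0]⟩
    have hrz' : B r z' = B r z := by simp [hz', hB r v, hvr]
    have hU : perp B (perp B (perp B W w) r) z' = perp B (perp B (perp B W v) r) z := by
      ext y
      simp only [mem_perp, hz', map_sub, map_smul, LinearMap.sub_apply, LinearMap.smul_apply,
        smul_eq_mul]
      have hry : B r y = B w y - (B v w / B v v) * B v y := by simp [hr]
      constructor
      · rintro ⟨⟨⟨hy, h1⟩, h2⟩, h3⟩
        rw [hry, h1, zero_sub, neg_eq_zero, mul_eq_zero] at h2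
        have h4 := h2.resolve_left (div_ne_zero hvw0 hvv)
        rw [h4, mul_zero, sub_zero] at h3
        exact ⟨⟨⟨hy, h4⟩, by rw [hry, h1, h4]; simp⟩, h3⟩
      · rintro ⟨⟨⟨hy, h1⟩, h2⟩, h3⟩
        have h4 : B w y = 0 := by rw [h1] at hry; rw [← h2, hry]; ring
        exact ⟨⟨⟨hy, h4⟩, h2⟩, by rw [h1, h3]; ring⟩
    -- Induction is used twice. Its first half compares discriminants up to c²; after r is rescaled
    -- by c they are equal, and its second half compares classes.
    have key : ∀ (p : V) (y : V) (τ : k) (t : M), perp B W p < W → OrthVal B g (perp B W p) τ t →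
        r ∈ perp B W p → y ∈ perp B W p → B r y = B r z →
        perp B (perp B (perp B W p) r) y = perp B (perp B (perp B W v) r) z →
        ∃ c ≠ 0, τ = -(c * B r z) ^ 2 * ε ∧ t = hypClass g (c * B r z) * u := by
      intro p y τ t hlt Ht hr hy hry e
      have Hu' := Hu
      rw [← e] at Hu'
      obtain ⟨⟨c, hc, rfl⟩, -⟩ := ih _ hlt _ _ _ _ (Hu'.plane hr hy hrr0 (by rwa [hry])) Ht
      rw [← perp_smul (v := r) hc] at Hu'
      have hcr : B (c • r) y = c * B r z := by simp [hry]
      have hτ : c ^ 2 * (-B r y ^ 2 * ε) = -(c * B r z) ^ 2 * ε := by rw [hry]; ring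
      refine ⟨c, hc, hτ, ?_⟩
      rw [← hcr]
      refine ((ih _ hlt _ _ _ _ (Hu'.plane (Submodule.smul_mem _ c hr) hy (by simp [hrr0])
        (by rw [hcr]; exact mul_ne_zero hc hrz)) Ht).2 ?_).symm
      rw [hcr, hτ]
    obtain ⟨c₁, hc₁, rfl, rfl⟩ := key v z _ _ hltv H₁ hrv hz rfl rfl
    obtain ⟨c₂, hc₂, rfl, rfl⟩ := key w z' _ _ hltw H₂ hrw hz'w hrz' hU
    have hε := Hu.ne_zero
    set s := B v w / B v v with hs
    have hs0 : s ≠ 0 := div_ne_zero hvw0 hvv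
    have hws : B w w = s ^ 2 * B v v := by
      rw [hs]; field_simp; linear_combination -hvw
    rw [hws]
    refine ⟨⟨s * c₂ / c₁, div_ne_zero (mul_ne_zero hs0 hc₂) hc₁, by field_simp⟩, fun e => ?_⟩
    rw [← mul_assoc, ← mul_assoc, hg.scale_hypClass hvv (mul_ne_zero hc₂ hrz) hs0]
    congr 2
    apply hypClass_congr
    have h1 : B v v * ε * ((c₁ * B r z) ^ 2) = B v v * ε * ((s * (c₂ * B r z)) ^ 2) := by
      linear_combination -e
    exact mul_left_cancel₀ (mul_ne_zero hvv hε) h1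
  · -- the plane spanned by `v` and `w` is non-degenerate
    have hrv : r ∈ perp B W v := mem_perp.2 ⟨hrW, hvr⟩
    obtain ⟨ε, u, Hu⟩ :=
      ((hWn.perp_line hB hv hvv).perp_line hB hrv hrr0).exists_orthVal hB g
    set r' : V := v - (B v w / B w w) • w with hr'
    have hr'r' : B r' r' = B v v * B r r / B w w := by
      rw [hrr]; simp [hr', hwv]; field_simp; ring
    have hr'0 : B r' r' ≠ 0 := by
      rw [hr'r']; exact div_ne_zero (mul_ne_zero hvv hrr0) hww
    have hr'w : r' ∈ perp B W w :=
      mem_perp.2 ⟨W.sub_mem hv (W.smul_mem _ hw), by simp [hr', hwv, hww]⟩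
    have hU : perp B (perp B W w) r' = perp B (perp B W v) r := by
      ext y
      simp only [mem_perp, hr', hr, map_sub, map_smul, LinearMap.sub_apply, LinearMap.smul_apply,
        smul_eq_mul]
      constructor
      · rintro ⟨⟨hy, h1⟩, h2⟩
        rw [h1, mul_zero, sub_zero] at h2
        exact ⟨⟨hy, h2⟩, by rw [h1, h2]; ring⟩
      · rintro ⟨⟨hy, h1⟩, h2⟩
        rw [h1, mul_zero, sub_zero] at h2
        exact ⟨⟨hy, h2⟩, by rw [h1, h2]; ring⟩
    -- The same double use of induction, with a line in place of a plane: y is rescaled until the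
    -- discriminants agree.
    have key : ∀ (p : V) (y : V) (τ : k) (t : M), perp B W p < W → OrthVal B g (perp B W p) τ t →
        y ∈ perp B W p → B y y ≠ 0 →
        perp B (perp B W p) y = perp B (perp B W v) r →
        ∃ c ≠ 0, τ = c ^ 2 * B y y * ε ∧ t = g (c ^ 2 * B y y) * u := by
      intro p y τ t hlt Ht hy hyy e
      have Hu' := Hu
      rw [← e] at Hu'
      obtain ⟨⟨c, hc, rfl⟩, -⟩ := ih _ hlt _ _ _ _ (Hu'.line hy hyy) Ht
      rw [← perp_smul hc] at Hu'
      have hcy : B (c • y) (c • y) = c ^ 2 * B y y := by simp; ring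
      refine ⟨c, hc, by ring, ?_⟩
      rw [← hcy]
      refine ((ih _ hlt _ _ _ _ (Hu'.line (Submodule.smul_mem _ c hy)
        (by rw [hcy]; positivity)) Ht).2 ?_).symm
      rw [hcy]; ring
    obtain ⟨c₁, hc₁, rfl, rfl⟩ := key v r _ _ hltv H₁ hrv hrr0 rfl
    obtain ⟨c₂, hc₂, rfl, rfl⟩ := key w r' _ _ hltw H₂ hr'w hr'0 hU
    have hε := Hu.ne_zero
    rw [hr'r']
    refine ⟨⟨c₂ / c₁, div_ne_zero hc₂ hc₁, by field_simp⟩, fun e => ?_⟩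
    have hcc : c₁ ^ 2 = c₂ ^ 2 := by
      have h1 : B v v * B r r * ε * c₁ ^ 2 = B v v * B r r * ε * c₂ ^ 2 := by
        field_simp at e; linear_combination (B v v * B r r * ε) * e
      exact mul_left_cancel₀ (mul_ne_zero (mul_ne_zero hvv hrr0) hε) h1
    rw [← mul_assoc, ← mul_assoc, ← hcc]
    congr 1
    -- In the orthogonal basis v, c₁ r the vector w has coordinates B v w / B v v and 1 / c₁, so
    -- `binary` exchanges the lines of v and c₁ r for those of w and a multiple of r'.
    have hw' : B w w = B v v * (B v w / B v v) ^ 2 + c₁ ^ 2 * B r r * (1 / c₁) ^ 2 := by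
      rw [hrr]; field_simp; ring
    have := hg.binary (B v v) (c₁ ^ 2 * B r r) (B v w / B v v) (1 / c₁) hvv (by positivity)
      (by rwa [← hw'])
    rw [← hw'] at this
    rw [this]
    congr 2
    ring

end OrthDecomp

/-! ### Unimodular symmetric bilinear forms over `k[X]` -/

section Hermite

variable {k : Type*} [Field k]

theorem det_of_column_zero {R : Type*} [CommRing R] {n : ℕ}
    (A : Matrix (Fin (n + 1)) (Fin (n + 1)) R) (h : ∀ i : Fin n, A i.succ 0 = 0) :
    A.det = A 0 0 * (A.submatrix Fin.succ Fin.succ).det := by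
  rw [Matrix.det_succ_column_zero, Fin.sum_univ_succ]
  simp [h]

theorem det_of_row_zero {R : Type*} [CommRing R] {n : ℕ}
    (A : Matrix (Fin (n + 1)) (Fin (n + 1)) R) (h : ∀ i : Fin n, A 0 i.succ = 0) :
    A.det = A 0 0 * (A.submatrix Fin.succ Fin.succ).det := by
  rw [← Matrix.det_transpose, det_of_column_zero A.transpose h, ← Matrix.det_transpose]
  rfl

theorem transpose_mul_mul_apply {R : Type*} [CommRing R] {n : Type*} [Fintype n]
    (P G : Matrix n n R) (i j : n) :
    (P.transpose * G * P) i j = ∑ x, ∑ y, P x i * G x y * P y j := by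
  simp only [Matrix.mul_apply, Matrix.transpose_apply, Finset.sum_mul]
  exact Finset.sum_comm

/-- The Gram matrix of the projections to the orthogonal of the first basis vector, scaled by
`G 0 0`. -/
def schurScaled {R : Type*} [CommRing R] {n : ℕ} (G : Matrix (Fin (n + 1)) (Fin (n + 1)) R) :
    Matrix (Fin n) (Fin n) R :=
  Matrix.of fun i j => G 0 0 * G i.succ j.succ - G 0 i.succ * G 0 j.succ

/-- Right multiplication by D scales the later columns of G by `G 0 0` and clears the rest of its
first row. -/
theorem det_schurScaled {R : Type*} [CommRing R] {n : ℕ}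
    {G : Matrix (Fin (n + 1)) (Fin (n + 1)) R} (hG : G.IsSymm) :
    G 0 0 * (schurScaled G).det = G 0 0 ^ n * G.det := by
  set D : Matrix (Fin (n + 1)) (Fin (n + 1)) R :=
    Matrix.of (Fin.cons (Fin.cons 1 fun j => -G 0 j.succ)
      fun i => Fin.cons 0 fun j => if i = j then G 0 0 else 0) with hD
  have hDdet : D.det = G 0 0 ^ n := by
    rw [det_of_column_zero D (fun i => by simp [hD])]
    have : D.submatrix Fin.succ Fin.succ = Matrix.diagonal fun _ => G 0 0 := by
      ext i j; simp [hD, Matrix.diagonal_apply]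
    rw [this, Matrix.det_diagonal]
    simp [hD]
  have hGD : (G * D).det = G 0 0 * (schurScaled G).det := by
    rw [det_of_row_zero (G * D)]
    · congr 1
      · simp [hD, Matrix.mul_apply, Fin.sum_univ_succ]
      · congr 1
        ext1 i j
        simp [Matrix.mul_apply, Fin.sum_univ_succ, hD, schurScaled, hG.apply i.succ 0]
        ring
    · intro i
      simp [Matrix.mul_apply, Fin.sum_univ_succ, hD]
      ring
  rw [← hGD, Matrix.det_mul, hDdet, mul_comm]

/-- The block matrix `[1, s; 0, Q]`. -/
def borderMatrix {R : Type*} [CommRing R] {n : ℕ} (s : R) (Q : Matrix (Fin n) (Fin n) R) :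
    Matrix (Fin (n + 1)) (Fin (n + 1)) R :=
  Matrix.of (Fin.cons (Fin.cons 1 fun _ => s) fun i => Fin.cons 0 (Q i))

theorem det_borderMatrix {R : Type*} [CommRing R] {n : ℕ} (s : R)
    (Q : Matrix (Fin n) (Fin n) R) : (borderMatrix s Q).det = Q.det := by
  rw [det_of_column_zero _ (fun i => by simp [borderMatrix])]
  have : (borderMatrix s Q).submatrix Fin.succ Fin.succ = Q := by ext i j; simp [borderMatrix]
  rw [this]
  simp [borderMatrix]

/-- Completing the square in the first variable, at the vector whose first coordinate is s and whose
others form column x of Q. -/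
theorem borderMatrix_congr_apply {R : Type*} [CommRing R] {n : ℕ}
    {G : Matrix (Fin (n + 1)) (Fin (n + 1)) R} (hG : G.IsSymm) (s : R)
    (Q : Matrix (Fin n) (Fin n) R) (x : Fin n) :
    G 0 0 * ((borderMatrix s Q).transpose * G * borderMatrix s Q) x.succ x.succ =
      (G 0 0 * s + ∑ j, G 0 j.succ * Q j x) ^ 2 + (Q.transpose * schurScaled G * Q) x x := by
  set l := ∑ j, G 0 j.succ * Q j x with hl
  have e1 : ((borderMatrix s Q).transpose * G * borderMatrix s Q) x.succ x.succ =
      s * G 0 0 * s + s * l + l * s +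
        ∑ i : Fin n, ∑ j : Fin n, Q i x * G i.succ j.succ * Q j x := by
    rw [transpose_mul_mul_apply, Fin.sum_univ_succ, Fin.sum_univ_succ]
    have h1 : ∀ i : Fin n, borderMatrix s Q i.succ x.succ = Q i x := fun i => by
      simp [borderMatrix]
    have h0 : borderMatrix s Q 0 x.succ = s := by simp [borderMatrix]
    have h2 : ∀ i : Fin n, ∑ y, borderMatrix s Q i.succ x.succ * G i.succ y *
        borderMatrix s Q y x.succ =
        G 0 i.succ * Q i x * s + ∑ j : Fin n, Q i x * G i.succ j.succ * Q j x := by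
      intro i
      rw [Fin.sum_univ_succ]
      simp only [h0, h1, hG.apply i.succ 0]
      ring
    rw [Finset.sum_congr rfl fun i _ => h2 i, Finset.sum_add_distrib]
    simp only [h0, h1, hl, Finset.mul_sum, Finset.sum_mul]
    rw [← add_assoc]
    congr 3
    exact Finset.sum_congr rfl fun _ _ => by ring
  have e2 : (Q.transpose * schurScaled G * Q) x x =
      G 0 0 * (∑ i : Fin n, ∑ j : Fin n, Q i x * G i.succ j.succ * Q j x) - l * l := by
    rw [transpose_mul_mul_apply, hl, Finset.sum_mul_sum, Finset.mul_sum,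
      ← Finset.sum_sub_distrib]
    refine Finset.sum_congr rfl fun i _ => ?_
    rw [Finset.mul_sum, ← Finset.sum_sub_distrib]
    refine Finset.sum_congr rfl fun j _ => ?_
    simp [schurScaled]; ring
  rw [e1, e2]; ring

theorem exists_forall_natVal_le {α : Type*} {p : α → Prop} {f : α → ℕ} (h : ∃ a, p a) :
    ∃ a, p a ∧ ∀ b, p b → f a ≤ f b := by
  classical
  have hex : ∃ d, ∃ a, p a ∧ f a = d := h.elim fun a ha => ⟨_, a, ha, rfl⟩
  obtain ⟨a, ha, hd⟩ := Nat.find_spec hex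
  exact ⟨a, ha, fun b hb => hd ▸ Nat.find_min' hex ⟨b, hb, rfl⟩⟩

/-- Hermite's bound on the minimum of a symmetric form over `k[X]`, attained at a vector of some
basis. -/
theorem exists_basis_hermite_bound (n : ℕ) : ∀ G : Matrix (Fin (n + 1)) (Fin (n + 1)) k[X],
    G.IsSymm → G.det ≠ 0 → ∃ P : Matrix (Fin (n + 1)) (Fin (n + 1)) k[X], IsUnit P.det ∧
      ((P.transpose * G * P) 0 0 = 0 ∨
        (n + 1) * ((P.transpose * G * P) 0 0).natDegree ≤ G.det.natDegree) := by
  induction n with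
  | zero =>
    intro G _ _
    exact ⟨1, by simp, Or.inr (by simp)⟩
  | succ n ih =>
  intro G₀ hG₀ hdet₀
  by_contra! hcon
  -- A supposed counterexample has no isotropic first vector in any basis, so one of minimal degree
  -- can be chosen.
  obtain ⟨P₀, hP₀, hmin₀⟩ : ∃ P : Matrix (Fin (n + 2)) (Fin (n + 2)) k[X], IsUnit P.det ∧
      ∀ Q : Matrix (Fin (n + 2)) (Fin (n + 2)) k[X], IsUnit Q.det →
        ((P.transpose * G₀ * P) 0 0).natDegree ≤ ((Q.transpose * G₀ * Q) 0 0).natDegree := by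
    exact exists_forall_natVal_le
      (p := fun P : Matrix (Fin (n + 2)) (Fin (n + 2)) k[X] => IsUnit P.det)
      (f := fun P => ((P.transpose * G₀ * P) 0 0).natDegree) ⟨1, by simp⟩
  obtain ⟨ha₀, hbig⟩ := hcon P₀ hP₀
  set G := P₀.transpose * G₀ * P₀ with hG
  have hsymm : G.IsSymm := by
    rw [Matrix.IsSymm, hG, Matrix.transpose_mul, Matrix.transpose_mul, Matrix.transpose_transpose,
      hG₀.eq, Matrix.mul_assoc]
  have hdetG : G.det.natDegree = G₀.det.natDegree ∧ G.det ≠ 0 := by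
    have h0 : P₀.det ≠ 0 := hP₀.ne_zero
    have e : G.det = P₀.det * G₀.det * P₀.det := by
      rw [hG, Matrix.det_mul, Matrix.det_mul, Matrix.det_transpose]
    refine ⟨?_, by rw [e]; exact mul_ne_zero (mul_ne_zero h0 hdet₀) h0⟩
    rw [e, natDegree_mul (mul_ne_zero h0 hdet₀) h0, natDegree_mul h0 hdet₀,
      natDegree_eq_zero_of_isUnit hP₀]
    ring
  rw [← hdetG.1] at hbig
  have hdet := hdetG.2
  have hmin : ∀ Q : Matrix (Fin (n + 2)) (Fin (n + 2)) k[X], IsUnit Q.det →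
      (Q.transpose * G * Q) 0 0 ≠ 0 ∧
        (G 0 0).natDegree ≤ ((Q.transpose * G * Q) 0 0).natDegree := by
    intro Q hQ
    have e : Q.transpose * G * Q = (P₀ * Q).transpose * G₀ * (P₀ * Q) := by
      rw [hG, Matrix.transpose_mul]; simp only [Matrix.mul_assoc]
    have hu : IsUnit (P₀ * Q).det := by rw [Matrix.det_mul]; exact hP₀.mul hQ
    rw [e]
    exact ⟨(hcon _ hu).1, hmin₀ _ hu⟩
  clear hmin₀ hcon
  clear_value G
  have hdet' : (schurScaled G).det = G 0 0 ^ n * G.det := by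
    refine mul_left_cancel₀ ha₀ ?_
    rw [det_schurScaled hsymm]; ring
  have hsymm' : (schurScaled G).IsSymm :=
    Matrix.IsSymm.ext fun i j => by simp [schurScaled, hsymm.apply i.succ j.succ, mul_comm]
  obtain ⟨Q, hQ, hQ'⟩ := ih (schurScaled G) hsymm' (by
    rw [hdet']; exact mul_ne_zero (pow_ne_zero _ ha₀) hdet)
  set l : k[X] := ∑ j, G 0 j.succ * Q j 0 with hl
  -- The first coordinate is minus a Euclidean quotient, so that the linear term in the completed
  -- square becomes the remainder `l % G 0 0`.
  set T := borderMatrix (-(l / G 0 0)) Q with hT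
  -- The swap makes the lifted vector the first vector of a basis, so minimality applies to it.
  have hT' := hmin (T.submatrix id (Equiv.swap 0 1)) (by
    rw [Matrix.det_permute', hT, det_borderMatrix]
    refine IsUnit.mul ?_ hQ
    rw [Equiv.Perm.sign_swap (by simp)]
    simp)
  have hTT : ((T.submatrix id (Equiv.swap 0 1)).transpose * G *
      T.submatrix id (Equiv.swap 0 1)) 0 0 = (T.transpose * G * T) (Fin.succ 0) (Fin.succ 0) := by
    rw [transpose_mul_mul_apply, transpose_mul_mul_apply]
    simp
  rw [hTT] at hT'
  have hkey := borderMatrix_congr_apply hsymm (-(l / G 0 0)) Q 0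
  rw [← hl, ← hT] at hkey
  have hrem : G 0 0 * -(l / G 0 0) + l = l % G 0 0 := by
    linear_combination -EuclideanDomain.div_add_mod l (G 0 0)
  rw [hrem] at hkey
  generalize (T.transpose * G * T) (Fin.succ 0) (Fin.succ 0) = q at hkey hT'
  generalize (Q.transpose * schurScaled G * Q) 0 0 = q' at hkey hQ'
  generalize G 0 0 = a at *
  obtain ⟨hq0, hqm⟩ := hT'
  -- The remainder has degree below deg a ≤ deg q, so its square cannot affect the leading term of a
  -- q. Thus q' is nonzero of degree deg a + deg q ≥ 2 deg a, and the inductive bound on q'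
  -- contradicts the failure of the bound for a.
  have hdlt : ((l % a) ^ 2).degree < (a * q).degree := by
    have h1 : (l % a).degree < a.degree := EuclideanDomain.mod_lt l ha₀
    rw [pow_two, degree_mul, degree_mul]
    have h2 : a.degree ≤ q.degree := by
      rw [degree_eq_natDegree ha₀, degree_eq_natDegree hq0]; exact_mod_cast hqm
    rcases eq_or_ne (l % a) 0 with h0 | h0
    · rw [h0, degree_zero, WithBot.bot_add, degree_eq_natDegree ha₀, degree_eq_natDegree hq0]
      exact_mod_cast WithBot.bot_lt_coe _
    · rw [degree_eq_natDegree h0, degree_eq_natDegree ha₀] at h1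
      rw [degree_eq_natDegree h0, degree_eq_natDegree ha₀, degree_eq_natDegree hq0]
      norm_cast at h1 ⊢
      omega
  have hq'd : q'.degree = (a * q).degree := by
    have : q' = a * q - (l % a) ^ 2 := by rw [hkey]; ring
    rw [this, degree_sub_eq_left_of_degree_lt hdlt]
  have hq'n : q'.natDegree = a.natDegree + q.natDegree := by
    rw [← natDegree_mul ha₀ hq0, natDegree, natDegree, hq'd]
  rcases hQ' with h | h
  · rw [h, degree_zero, eq_comm, degree_eq_bot] at hq'd
    exact mul_ne_zero ha₀ hq0 hq'd
  · rw [hdet', natDegree_mul (pow_ne_zero _ ha₀) hdet, natDegree_pow, hq'n] at h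
    have : (n + 1) * (a.natDegree + a.natDegree) ≤ n * a.natDegree + G.det.natDegree :=
      (Nat.mul_le_mul_left _ (Nat.add_le_add_left hqm _)).trans h
    refine absurd hbig (not_lt.2 ?_)
    nlinarith

/-- Every linear functional on `N` is represented by an element of `N`. -/
def UnimodularOn {R L : Type*} [CommRing R] [AddCommGroup L] [Module R L]
    (B : LinearMap.BilinForm R L) (N : Submodule R L) : Prop :=
  ∀ f : N →ₗ[R] R, ∃ n ∈ N, ∀ x : N, f x = B n x

/-- A functional on N' is pulled back along the orthogonal projection π, represented in N, and its
representative is projected back. -/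
theorem UnimodularOn.of_projection {R L : Type*} [CommRing R] [AddCommGroup L] [Module R L]
    {B : LinearMap.BilinForm R L} {N N' : Submodule R L} (hN : UnimodularOn B N)
    (hle : N' ≤ N) (π : L →ₗ[R] L) (h1 : ∀ x ∈ N, π x ∈ N') (h2 : ∀ x ∈ N', π x = x)
    (h3 : ∀ x ∈ N, ∀ y ∈ N', B (π x) y = B x y) : UnimodularOn B N' := by
  intro f
  obtain ⟨n, hn, h⟩ := hN (f ∘ₗ π.restrict h1)
  refine ⟨π n, h1 n hn, fun x => ?_⟩
  rw [h3 n hn x x.2, ← h ⟨x, hle x.2⟩]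
  simp only [LinearMap.comp_apply]
  congr 1
  ext
  simp [h2 x x.2]

theorem UnimodularOn.perp_line {R L : Type*} [CommRing R] [AddCommGroup L] [Module R L]
    {B : LinearMap.BilinForm R L} {N : Submodule R L} (hN : UnimodularOn B N) {v : L}
    (hv : v ∈ N) {c : R} (hc : c * B v v = 1) : UnimodularOn B (perp B N v) := by
  refine hN.of_projection (perp_le B N v) (LinearMap.id - c • (B v).smulRight v) ?_ ?_ ?_
  · intro x hx
    refine mem_perp.2 ⟨?_, ?_⟩
    · simpa using N.sub_mem hx (N.smul_mem _ (N.smul_mem _ hv))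
    · simp; linear_combination (-B v x) * hc
  · intro x hx
    simp [(mem_perp.1 hx).2]
  · intro x _ y hy
    simp [(mem_perp.1 hy).2]

theorem UnimodularOn.perp_plane {R L : Type*} [CommRing R] [AddCommGroup L] [Module R L]
    {B : LinearMap.BilinForm R L} (hB : ∀ x y, B x y = B y x) {N : Submodule R L}
    (hN : UnimodularOn B N) {r z : L} (hr : r ∈ N) (hz : z ∈ N) (h0 : B r r = 0)
    (h1 : B r z = 1) : UnimodularOn B (perp B (perp B N r) z) := by
  refine hN.of_projection ((perp_le _ _ _).trans (perp_le _ _ _))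
    (LinearMap.id - (B r).smulRight z - (B z - B z z • B r).smulRight r) ?_ ?_ ?_
  · intro x hx
    refine mem_perp.2 ⟨mem_perp.2 ⟨?_, ?_⟩, ?_⟩
    · simpa using N.sub_mem (N.sub_mem hx (N.smul_mem _ hz)) (N.smul_mem _ hr)
    · simp [h0, h1]
    · simp [hB z r, h1]; ring
  · intro x hx
    simp [(mem_perp.1 hx).2, (mem_perp.1 (mem_perp.1 hx).1).2]
  · intro x _ y hy
    simp [(mem_perp.1 hy).2, (mem_perp.1 (mem_perp.1 hy).1).2]

/-- A nonzero unimodular form over `k[X]` represents a unit, or contains a hyperbolic plane. -/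
theorem UnimodularOn.exists_unit_or_isotropic {L : Type*} [AddCommGroup L] [Module k[X] L]
    [Module.Free k[X] L] [Module.Finite k[X] L] {B : LinearMap.BilinForm k[X] L}
    (hB : ∀ x y, B x y = B y x) {N : Submodule k[X] L} (hN : UnimodularOn B N) (h0 : N ≠ ⊥) :
    ∃ v ∈ N, (∃ a ≠ 0, B v v = C a) ∨ (B v v = 0 ∧ ∃ z ∈ N, B v z = 1) := by
  obtain ⟨m, b⟩ : Σ m, Module.Basis (Fin m) k[X] N := ⟨_, Module.finBasis k[X] N⟩
  obtain _ | n := m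
  · exact absurd ((Submodule.subsingleton_iff_eq_bot).1
      ⟨fun x y => b.ext_elem fun i => i.elim0⟩) h0
  set G : Matrix (Fin (n + 1)) (Fin (n + 1)) k[X] := Matrix.of fun i j => B (b i) (b j) with hG
  have hsymm : G.IsSymm := Matrix.IsSymm.ext fun i j => hB _ _
  have hdet : IsUnit G.det := by
    -- The vectors representing the coordinate functionals form a dual basis; their coordinates give
    -- the inverse of the Gram matrix.
    choose d hd hd' using fun i => hN (b.coord i)
    refine Matrix.isUnit_det_of_left_inverse
      (B := Matrix.of fun i j => b.repr ⟨d i, hd i⟩ j) ?_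
    ext1 i j
    have h1 : ∑ l, b.repr ⟨d i, hd i⟩ l • (b l : L) = d i := by
      have h := congrArg N.subtype (b.sum_repr ⟨d i, hd i⟩)
      rwa [map_sum] at h
    have h2 := hd' i (b j)
    rw [← h1] at h2
    simp only [map_sum, map_smul, LinearMap.sum_apply, LinearMap.smul_apply] at h2
    rw [Matrix.mul_apply]
    simp only [Matrix.of_apply, hG]
    simp only [smul_eq_mul] at h2
    rw [← h2, Module.Basis.coord_apply, Module.Basis.repr_self, Finsupp.single_apply,
      Matrix.one_apply]
    simp only [eq_comm]
  obtain ⟨P, hP, h⟩ := exists_basis_hermite_bound n G hsymm hdet.ne_zero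
  set v : N := ∑ i, P i 0 • b i with hv
  have hvv : B v v = (P.transpose * G * P) 0 0 := by
    rw [transpose_mul_mul_apply, hv]
    simp only [Submodule.coe_sum, Submodule.coe_smul, map_sum, map_smul, LinearMap.sum_apply,
      LinearMap.smul_apply, smul_eq_mul, hG, Matrix.of_apply, Finset.mul_sum]
    exact Finset.sum_congr rfl fun i _ => Finset.sum_congr rfl fun j _ => by
      rw [hB (b j)]; ring
  -- The determinant has degree 0, so Hermite's bound leaves only the value zero or a nonzero
  -- constant.
  rw [natDegree_eq_zero_of_isUnit hdet, ← hvv] at h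
  refine ⟨v, v.2, ?_⟩
  by_cases hq : B v v = 0
  · right
    refine ⟨hq, ?_⟩
    -- The first row of P⁻¹ is the coordinate along v in the basis given by P, hence a functional
    -- with value 1 at v.
    obtain ⟨z, hz, hz'⟩ := hN (∑ i, P⁻¹ 0 i • b.coord i)
    refine ⟨z, hz, ?_⟩
    rw [hB, ← hz' v]
    have : (P⁻¹ * P) 0 0 = 1 := by rw [Matrix.nonsing_inv_mul _ hP]; simp
    rw [← this, Matrix.mul_apply]
    simp [hv, Finsupp.single_apply, mul_comm]
  · left
    have hd := h.resolve_left hq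
    have hd : (B v v).natDegree = 0 := by
      rcases Nat.eq_zero_of_le_zero hd with h
      simpa using h
    rw [eq_C_of_natDegree_eq_zero hd] at hq ⊢
    exact ⟨_, fun e => hq (by rw [e, C_0]), rfl⟩

/-! ### Specialization of unimodular forms -/

instance evalRingHom_surjective {R : Type*} [CommRing R] (t : R) :
    RingHomSurjective (evalRingHom t) :=
  ⟨fun c => ⟨C c, by simp⟩⟩

variable {V L M : Type*} [AddCommGroup V] [Module k V] [CommMonoid M]
  [AddCommGroup L] [Module k[X] L]

/-- A lift x of a vector orthogonal to v at t is corrected by a multiple of v. Since `B v v` is a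
constant unit, this multiple exists over `k[X]`, and it vanishes at t. -/
theorem map_perp_line {t : k} {B : LinearMap.BilinForm k[X] L} {Bt : LinearMap.BilinForm k V}
    {ev : L →ₛₗ[evalRingHom t] V} (hev : ∀ x y, Bt (ev x) (ev y) = (B x y).eval t)
    {N : Submodule k[X] L} {v : L} (hv : v ∈ N) {a : k} (ha : a ≠ 0) (hva : B v v = C a) :
    (perp B N v).map ev = perp Bt (N.map ev) (ev v) := by
  ext y
  simp only [mem_perp, Submodule.mem_map]
  constructor
  · rintro ⟨x, ⟨hx, hx'⟩, rfl⟩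
    exact ⟨⟨x, hx, rfl⟩, by rw [hev, hx']; simp⟩
  · rintro ⟨⟨x, hx, rfl⟩, h⟩
    rw [hev] at h
    refine ⟨x - (C a⁻¹ * B v x) • v, ⟨N.sub_mem hx (N.smul_mem _ hv), ?_⟩, ?_⟩
    · rw [map_sub, map_smul, hva, smul_eq_mul, mul_right_comm, ← C_mul, inv_mul_cancel₀ ha]
      simp
    · rw [map_sub, map_smulₛₗ]
      simp [h]

theorem map_perp_plane {t : k} {B : LinearMap.BilinForm k[X] L} (hB : ∀ x y, B x y = B y x)
    {Bt : LinearMap.BilinForm k V}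
    {ev : L →ₛₗ[evalRingHom t] V} (hev : ∀ x y, Bt (ev x) (ev y) = (B x y).eval t)
    {N : Submodule k[X] L} {r z : L} (hr : r ∈ N) (hz : z ∈ N) (h0 : B r r = 0)
    (h1 : B r z = 1) :
    (perp B (perp B N r) z).map ev = perp Bt (perp Bt (N.map ev) (ev r)) (ev z) := by
  ext y
  simp only [mem_perp, Submodule.mem_map]
  constructor
  · rintro ⟨x, ⟨⟨hx, hx'⟩, hx''⟩, rfl⟩
    exact ⟨⟨⟨x, hx, rfl⟩, by rw [hev, hx']; simp⟩, by rw [hev, hx'']; simp⟩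
  · rintro ⟨⟨⟨x, hx, rfl⟩, h⟩, h'⟩
    rw [hev] at h h'
    refine ⟨x - B r x • z - (B z x - B r x * B z z) • r,
      ⟨⟨N.sub_mem (N.sub_mem hx (N.smul_mem _ hz)) (N.smul_mem _ hr), ?_⟩, ?_⟩, ?_⟩
    · simp [h0, h1]
    · simp [hB z r, h1]
    · rw [map_sub, map_sub, map_smulₛₗ, map_smulₛₗ]
      simp [h, h']

/-- The specializations of a unimodular form over `k[X]` have orthogonal decompositions with the
same discriminant and the same class. -/
theorem UnimodularOn.exists_orthVal [FiniteDimensional k V] [Module.Free k[X] L] [Module.Finite k[X] L]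
    {B : LinearMap.BilinForm k[X] L} (hB : ∀ x y, B x y = B y x)
    {Bt : k → LinearMap.BilinForm k V}
    {ev : ∀ t : k, L →ₛₗ[evalRingHom t] V}
    (hev : ∀ t x y, Bt t (ev t x) (ev t y) = (B x y).eval t) (g : k → M)
    {N : Submodule k[X] L} (hN : UnimodularOn B N) :
    ∃ δ₀, ∀ c ≠ 0, (N = ⊥ → c = 1) → ∃ x, ∀ t, OrthVal (Bt t) g (N.map (ev t)) (c ^ 2 * δ₀) x := by
  -- Induction on the fibre at 0. The scalar c is absorbed by the first vector split off, the
  -- remaining summands being taken with scalar 1; the zero module has nothing to rescale.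
  generalize hW : N.map (ev 0) = W
  induction W using WellFoundedLT.induction generalizing N with
  | _ W ih =>
  by_cases hN0 : N = ⊥
  · subst hN0
    refine ⟨1, fun c _ h => ⟨1, fun t => ?_⟩⟩
    rw [h rfl, Submodule.map_bot, one_pow, one_mul]
    exact OrthVal.bot
  obtain ⟨v, hv, ⟨a, ha, hva⟩ | ⟨hvv, z, hz, hvz⟩⟩ := hN.exists_unit_or_isotropic hB hN0
  · have hc : C a⁻¹ * B v v = 1 := by rw [hva, ← C_mul, inv_mul_cancel₀ ha, C_1]
    have hvt : ∀ t, Bt t (ev t v) (ev t v) = a := fun t => by rw [hev, hva, eval_C]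
    have hm := fun t => map_perp_line (hev t) hv ha hva
    obtain ⟨δ, h⟩ := ih _ (by
      rw [hm, ← hW]
      exact perp_lt (Submodule.mem_map_of_mem hv) (by rwa [hvt])) (hN.perp_line hv hc) rfl
    obtain ⟨x, hx⟩ := h 1 one_ne_zero fun _ => rfl
    refine ⟨a * δ, fun c hc _ => ⟨g (c ^ 2 * a) * x, fun t => ?_⟩⟩
    have hx' := hx t
    rw [hm, ← perp_smul hc] at hx'
    have hcv : Bt t (c • ev t v) (c • ev t v) = c ^ 2 * a := by simp [hvt]; ring
    have := hx'.line (Submodule.smul_mem _ c (Submodule.mem_map_of_mem hv))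
      (by rw [hcv]; positivity)
    rw [hcv] at this
    convert this using 1
    ring
  · have hr : ∀ t, Bt t (ev t v) (ev t v) = 0 := fun t => by rw [hev, hvv, eval_zero]
    have hrz : ∀ t, Bt t (ev t v) (ev t z) = 1 := fun t => by rw [hev, hvz, eval_one]
    have hm := fun t => map_perp_plane hB (hev t) hv hz hvv hvz
    obtain ⟨δ, h⟩ := ih _ (by
      rw [hm, ← hW]
      exact (perp_le _ _ _).trans_lt (perp_lt (Submodule.mem_map_of_mem hz) (by
        rw [hrz]; exact one_ne_zero))) (hN.perp_plane hB hv hz hvv hvz) rfl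
    obtain ⟨x, hx⟩ := h 1 one_ne_zero fun _ => rfl
    refine ⟨-δ, fun c hc _ => ⟨hypClass g c * x, fun t => ?_⟩⟩
    have hx' := hx t
    rw [hm, ← perp_smul (v := ev t v) hc] at hx'
    have hcv : Bt t (c • ev t v) (ev t z) = c := by simp [hrz]
    have := hx'.plane (Submodule.smul_mem _ c (Submodule.mem_map_of_mem hv))
      (Submodule.mem_map_of_mem hz) (by simp [hr]) (by rwa [hcv])
    rw [hcv] at this
    convert this using 1
    ring

end Hermite

/-! ### Naive homotopies of symmetric matrices -/

namespace SymMat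

section Ring

variable {R : Type*} [CommRing R] {n m : ℕ}

/-- The congruent matrix `Pᵀ S P`. -/
def congr (S : SymMat n R) (P : Matrix (Fin n) (Fin n) R) (hP : IsUnit P.det) : SymMat n R where
  M := P.transpose * S.M * P
  isSymm := by
    rw [Matrix.IsSymm, Matrix.transpose_mul, Matrix.transpose_mul, Matrix.transpose_transpose,
      S.isSymm.eq, Matrix.mul_assoc]
  isUnit_det := by
    rw [Matrix.det_mul, Matrix.det_mul, Matrix.det_transpose]
    exact (hP.mul S.isUnit_det).mul hP

theorem toPi0_eq_of_path (S : SymMat n R) (P : Matrix (Fin n) (Fin n) R[X]) (hP : IsUnit P.det)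
    (h0 : P.map (evalRingHom 0) = 1) {T : SymMat n R}
    (hT : T.M = (P.map (evalRingHom 1)).transpose * S.M * P.map (evalRingHom 1)) :
    S.toPi0 = T.toPi0 := by
  have key : ∀ t, ((S.const.congr P hP).evalAt t).M =
      (P.map (evalRingHom t)).transpose * S.M * P.map (evalRingHom t) := by
    intro t
    have : S.M = (S.const.evalAt t).M := by rw [evalAt_const]
    rw [this]
    change (P.transpose * S.const.M * P).map (evalRingHom t) = _
    rw [Matrix.map_mul, Matrix.map_mul, Matrix.transpose_map]
    rfl
  have e0 : (S.const.congr P hP).evalAt 0 = S := by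
    ext1; rw [key, h0]; simp
  have e1 : (S.const.congr P hP).evalAt 1 = T := by
    ext1; rw [key, hT]
  have := toPi0_evalAt (S.const.congr P hP)
  rwa [e0, e1] at this

/-- The segment `1 + X (U - 1)` from the identity to U stays unipotent, so its determinant is 1
throughout. -/
theorem toPi0_eq_of_upper {S T : SymMat n R} (U : Matrix (Fin n) (Fin n) R)
    (hd : ∀ i, U i i = 1) (hU : ∀ i j, j < i → U i j = 0)
    (hT : T.M = U.transpose * S.M * U) : S.toPi0 = T.toPi0 := by
  set P : Matrix (Fin n) (Fin n) R[X] := 1 + (X : R[X]) • (U - 1).map C with hP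
  have hev : ∀ t, P.map (evalRingHom t) = 1 + t • (U - 1) := by
    intro t
    ext i j
    by_cases hij : i = j
    · simp [hP, hij]
    · simpa [hP, hij] using mul_comm _ _
  refine S.toPi0_eq_of_path P ?_ (by rw [hev]; simp) (by rw [hev, hT]; simp)
  rw [Matrix.det_of_isUpperTriangular]
  · simp [hP, hd]
  · intro i j hij
    have hij' : j < i := hij
    simp [hP, hU i j hij', hij'.ne']

theorem toPi0_eq_of_lower {S T : SymMat n R} (U : Matrix (Fin n) (Fin n) R)
    (hd : ∀ i, U i i = 1) (hU : ∀ i j, i < j → U i j = 0)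
    (hT : T.M = U.transpose * S.M * U) : S.toPi0 = T.toPi0 := by
  set P : Matrix (Fin n) (Fin n) R[X] := 1 + (X : R[X]) • (U - 1).map C with hP
  have hev : ∀ t, P.map (evalRingHom t) = 1 + t • (U - 1) := by
    intro t
    ext i j
    by_cases hij : i = j
    · simp [hP, hij]
    · simpa [hP, hij] using mul_comm _ _
  refine S.toPi0_eq_of_path P ?_ (by rw [hev]; simp) (by rw [hev, hT]; simp)
  rw [Matrix.det_of_isLowerTriangular]
  · simp [hP, hd]
  · intro i j hij
    have hij' : i < j := hij
    simp [hP, hU i j hij', hij'.ne]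

/-- The form `⟨u⟩` of rank one. -/
def rankOne (u : Rˣ) : SymMat 1 R where
  M := Matrix.of fun _ _ => (u : R)
  isSymm := Matrix.IsSymm.ext fun _ _ => rfl
  isUnit_det := by simp

/-- The binary form with matrix `[p, d; d, c]`. -/
def binary (p d c : R) (h : IsUnit (p * c - d ^ 2)) : SymMat 2 R where
  M := !![p, d; d, c]
  isSymm := by
    refine Matrix.IsSymm.ext fun i j => ?_
    fin_cases i <;> fin_cases j <;> rfl
  isUnit_det := by rwa [Matrix.det_fin_two_of, ← pow_two]

theorem mk_mul_mk (a : SymMat n R) (b : SymMat m R) :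
    (GradedMonoid.mk n a.toPi0 : GradedMonoid (Pi0 R)) * GradedMonoid.mk m b.toPi0 =
      GradedMonoid.mk (n + m) (a.add b).toPi0 := rfl

theorem mk_rankOne_mul_mk_rankOne (u v : Rˣ) :
    (GradedMonoid.mk 1 (rankOne u).toPi0 : GradedMonoid (Pi0 R)) *
      GradedMonoid.mk 1 (rankOne v).toPi0 =
      GradedMonoid.mk 2 (binary (u : R) 0 (v : R) (by simp)).toPi0 := by
  rw [mk_mul_mk]
  refine mk_toPi0_eq rfl fun i j => ?_
  fin_cases i <;> fin_cases j <;> rfl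

theorem toPi0_binary_lower {p d c : R} (x : R) (h : IsUnit (p * c - d ^ 2)) {p' d' c' : R}
    (h' : IsUnit (p' * c' - d' ^ 2)) (hp : p' = p + 2 * d * x + c * x ^ 2) (hd : d' = d + c * x)
    (hc : c' = c) :
    (binary p d c h).toPi0 = (binary p' d' c' h').toPi0 := by
  subst hp hd hc
  refine toPi0_eq_of_lower !![1, 0; x, 1] ?_ ?_ ?_
  · intro i; fin_cases i <;> rfl
  · intro i j hij; fin_cases i <;> fin_cases j <;> simp at hij ⊢
  · simp only [binary]
    ext i j
    fin_cases i <;> fin_cases j <;>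
      simp [Matrix.mul_apply, Fin.sum_univ_two] <;> ring

end Ring

/-! ### Symmetric matrices over a field: rank two relations and generators -/

section Field

variable {k : Type*} [Field k] {n m : ℕ}

theorem toPi0_congr_of_ne_zero (S : SymMat 2 k) {p q r s : k} (hr : r ≠ 0)
    (hdet : p * s - q * r = 1) (h : IsUnit (!![p, q; r, s] : Matrix (Fin 2) (Fin 2) k).det) :
    S.toPi0 = (S.congr !![p, q; r, s] h).toPi0 := by
  have h1 : ∀ x : k, IsUnit (!![1, x; 0, 1] : Matrix (Fin 2) (Fin 2) k).det := fun x => by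
    simp [Matrix.det_fin_two_of]
  have h2 : IsUnit (!![1, 0; r, 1] : Matrix (Fin 2) (Fin 2) k).det := by
    simp [Matrix.det_fin_two_of]
  have hup : ∀ (x : k) (S : SymMat 2 k), S.toPi0 = (S.congr !![1, x; 0, 1] (h1 x)).toPi0 := by
    intro x S
    refine toPi0_eq_of_upper _ ?_ ?_ rfl
    · intro i; fin_cases i <;> rfl
    · intro i j hij; fin_cases i <;> fin_cases j <;> simp at hij ⊢
  have hlo : ∀ (S : SymMat 2 k), S.toPi0 = (S.congr !![1, 0; r, 1] h2).toPi0 := by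
    intro S
    refine toPi0_eq_of_lower _ ?_ ?_ rfl
    · intro i; fin_cases i <;> rfl
    · intro i j hij; fin_cases i <;> fin_cases j <;> simp at hij ⊢
  -- With r ≠ 0 an element of SL₂ is a product of three unipotent matrices, each joined to the
  -- identity.
  have e : (!![p, q; r, s] : Matrix (Fin 2) (Fin 2) k) =
      !![1, (p - 1) / r; 0, 1] * !![1, 0; r, 1] * !![1, (s - 1) / r; 0, 1] := by
    have hq : q = (p * s - 1) / r := by field_simp; linear_combination -hdet
    subst hq
    ext i j
    fin_cases i <;> fin_cases j <;>
      simp [Matrix.mul_apply, Fin.sum_univ_two] <;> field_simp <;> ring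
  refine (hup ((p - 1) / r) S).trans ((hlo _).trans ((hup ((s - 1) / r) _).trans ?_))
  refine congrArg toPi0 (SymMat.ext ?_)
  simp only [congr]
  rw [e]
  simp only [Matrix.transpose_mul, Matrix.mul_assoc]

/-- Binary forms that are congruent under `SL₂` are in the same naive connected component. -/
theorem toPi0_congr_of_det_eq_one (S : SymMat 2 k) {p q r s : k} (hdet : p * s - q * r = 1)
    (h : IsUnit (!![p, q; r, s] : Matrix (Fin 2) (Fin 2) k).det) :
    S.toPi0 = (S.congr !![p, q; r, s] h).toPi0 := by
  by_cases hr : r = 0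
  · have hp : p ≠ 0 := by rintro rfl; simp [hr] at hdet
    -- A Weyl element is factored out; both factors then have nonzero lower left entry.
    have hW : IsUnit (!![0, 1; -1, 0] : Matrix (Fin 2) (Fin 2) k).det := by
      simp [Matrix.det_fin_two_of]
    have hd : (-r) * q - (-s) * p = 1 := by linear_combination hdet
    have hV : IsUnit (!![-r, -s; p, q] : Matrix (Fin 2) (Fin 2) k).det := by
      rw [Matrix.det_fin_two_of, hd]; exact isUnit_one
    have e : (!![p, q; r, s] : Matrix (Fin 2) (Fin 2) k) =
        !![0, 1; -1, 0] * !![-r, -s; p, q] := by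
      ext i j
      fin_cases i <;> fin_cases j <;> simp [Matrix.mul_apply, Fin.sum_univ_two]
    refine (toPi0_congr_of_ne_zero S (r := -1) (by simp) (by ring) hW).trans
      ((toPi0_congr_of_ne_zero _ hp hd hV).trans ?_)
    refine congrArg toPi0 (SymMat.ext ?_)
    simp only [congr]
    rw [e]
    simp only [Matrix.transpose_mul, Matrix.mul_assoc]
  · exact toPi0_congr_of_ne_zero S hr hdet h

/-- The second column (y, x) of the SL₂ matrix is a vector of value a'; the first column is the
orthogonal vector that makes the determinant 1. -/
theorem toPi0_binary_diag {a b x y a' : k} (ha' : a' = a * x ^ 2 + b * y ^ 2) (h0 : a' ≠ 0)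
    (h : IsUnit (b * a - 0 ^ 2)) (h' : IsUnit (a * b / a' * a' - 0 ^ 2)) :
    (binary b 0 a h).toPi0 = (binary (a * b / a') 0 a' h').toPi0 := by
  have hdet : a * x / a' * x - y * (-(b * y / a')) = 1 := by
    field_simp; linear_combination -ha'
  rw [toPi0_congr_of_det_eq_one (binary b 0 a h) hdet
    (by rw [Matrix.det_fin_two_of, hdet]; exact isUnit_one)]
  congr 1
  ext1
  simp only [congr, binary]
  ext i j
  fin_cases i <;> fin_cases j <;>
    simp [Matrix.mul_apply, Fin.sum_univ_two]
  · field_simp; rw [ha']; ring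
  · field_simp; ring
  · field_simp; ring
  · rw [ha']; ring

/-- The determinant of [0, c; c, d] does not involve d, so d moves linearly to 1; completing the
square diagonalizes both ends. -/
theorem toPi0_binary_hyperbolic {c d : k} (hd : d ≠ 0) (h : IsUnit (-c ^ 2 / d * d - 0 ^ 2))
    (h' : IsUnit (-c ^ 2 * 1 - 0 ^ 2)) :
    (binary (-c ^ 2 / d) 0 d h).toPi0 = (binary (-c ^ 2) 0 1 h').toPi0 := by
  have hc : c ≠ 0 := by rintro rfl; simp at h'
  have hu : ∀ e : k, IsUnit (0 * e - c ^ 2) := fun e => by simp [hc]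
  have hu' : IsUnit (0 * (C d + X * C (1 - d)) - C c ^ 2 : k[X]) := by
    rw [zero_mul, zero_sub, ← C_pow, ← C_neg]
    exact (isUnit_iff_ne_zero.2 (neg_ne_zero.2 (pow_ne_zero 2 hc))).map C
  have e1 : (binary 0 c d (hu d)).toPi0 = (binary (-c ^ 2 / d) 0 d h).toPi0 :=
    toPi0_binary_lower (-c / d) _ _ (by field_simp; ring) (by field_simp; ring) rfl
  have e2 : (binary 0 c 1 (hu 1)).toPi0 = (binary (-c ^ 2) 0 1 h').toPi0 :=
    toPi0_binary_lower (-c) _ _ (by ring) (by ring) rfl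
  have e3 := toPi0_evalAt (binary (0 : k[X]) (C c) (C d + X * C (1 - d)) hu')
  rw [← e1, ← e2]
  convert e3 using 2
  · ext i j; fin_cases i <;> fin_cases j <;> simp [evalAt, map, binary]
  · ext i j; fin_cases i <;> fin_cases j <;> simp [evalAt, map, binary]

/-- The class of the form `⟨u⟩`. -/
def rankOneClass (u : kˣ) : GradedMonoid (Pi0 k) := GradedMonoid.mk 1 (rankOne u).toPi0

theorem rankOneClass_mul_rankOneClass_comm (u v : kˣ) :
    rankOneClass u * rankOneClass v = rankOneClass v * rankOneClass u := by
  rw [rankOneClass, rankOneClass, mk_rankOne_mul_mk_rankOne, mk_rankOne_mul_mk_rankOne]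
  have := toPi0_binary_diag (a := (v : k)) (b := u) (x := 0) (y := 1) (a' := u) (by ring)
    u.ne_zero (by simp) (by simp)
  rw [this]
  congr 3
  field_simp

theorem exists_mk_eq_rankOneClass_mul (S : SymMat (n + 1) k) (h : S.M 0 0 ≠ 0) :
    ∃ (u : kˣ) (S' : SymMat n k),
      GradedMonoid.mk (n + 1) S.toPi0 = rankOneClass u * GradedMonoid.mk n S'.toPi0 := by
  set a := S.M 0 0 with ha
  -- One Gram–Schmidt step: U is upper unipotent and clears the first row and column of S beyond the
  -- diagonal.
  set U := borderMatrix 0 (1 : Matrix (Fin n) (Fin n) k) -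
    Matrix.of (Fin.cons (Fin.cons 0 fun j => S.M 0 j.succ / a) fun _ => 0) with hU
  have hU00 : U 0 0 = 1 := by simp [hU, borderMatrix]
  have hU0 : ∀ j : Fin n, U 0 j.succ = -(S.M 0 j.succ / a) := fun j => by simp [hU, borderMatrix]
  have hUc : ∀ i : Fin n, U i.succ 0 = 0 := fun i => by simp [hU, borderMatrix]
  have hUs : ∀ i j : Fin n, U i.succ j.succ = if i = j then 1 else 0 := fun i j => by
    simp [hU, borderMatrix, Matrix.one_apply]
  have hsub : U.submatrix Fin.succ Fin.succ = 1 := by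
    ext i j; simp [hUs, Matrix.one_apply]
  have hUdet : U.det = 1 := by rw [det_of_column_zero U hUc, hU00, hsub]; simp
  have hS := S.isSymm.apply
  set T := S.congr U (by rw [hUdet]; exact isUnit_one) with hT
  have hTsymm := T.isSymm.apply
  have hT00 : T.M 0 0 = a := by
    simp [hT, congr, transpose_mul_mul_apply, Fin.sum_univ_succ, hU00, hUc, ha]
  have hT0 : ∀ j : Fin n, T.M 0 j.succ = 0 := fun j => by
    simp [hT, congr, transpose_mul_mul_apply, Fin.sum_univ_succ, hU00, hU0, hUc, hUs, ← ha]
    field_simp; ring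
  have hTc : ∀ j : Fin n, T.M j.succ 0 = 0 := fun j => by rw [hTsymm]; exact hT0 j
  have hST : S.toPi0 = T.toPi0 := by
    refine toPi0_eq_of_upper U ?_ ?_ rfl
    · intro i
      refine Fin.cases hU00 (fun i => ?_) i
      simp [hUs]
    · intro i j
      refine Fin.cases (fun h => absurd h (Fin.not_lt_zero _)) (fun i => ?_) i
      refine Fin.cases (fun _ => hUc i) (fun j hij => ?_) j
      rw [hUs, if_neg]
      rintro rfl
      exact lt_irrefl _ hij
  have hTdet := T.isUnit_det
  rw [det_of_column_zero T.M hTc, hT00] at hTdet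
  refine ⟨Units.mk0 a h, ⟨T.M.submatrix Fin.succ Fin.succ, T.isSymm.submatrix _,
    isUnit_of_mul_isUnit_right hTdet⟩, ?_⟩
  rw [hST, rankOneClass, mk_mul_mk]
  refine mk_toPi0_eq (add_comm n 1) fun i j => ?_
  have hz : Fin.cast (add_comm n 1) (0 : Fin (n + 1)) = Fin.castAdd n 0 := rfl
  have hs : ∀ i : Fin n, Fin.cast (add_comm n 1) i.succ = Fin.natAdd 1 i := fun i => by
    ext; simp [add_comm]
  refine Fin.cases ?_ (fun i => ?_) i <;> refine Fin.cases ?_ (fun j => ?_) j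
  · rw [hz, add_M_castAdd_castAdd, hT00]; rfl
  · rw [hz, hs, add_M_castAdd_natAdd, hT0]
  · rw [hz, hs, add_M_natAdd_castAdd, hTc]
  · rw [hs, hs, add_M_natAdd_natAdd]; rfl

/-- Multiplying S by E adds X c times the square of its first row, which keeps it symmetric. As `S.M
0 0 = 0`, E is unipotent. This is not a congruence, and it can leave the alternating matrices in
characteristic 2. -/
theorem exists_toPi0_eq_of_apply_zero_eq_zero (S : SymMat (n + 1) k) (h : S.M 0 0 = 0) (c : k) :
    ∃ S' : SymMat (n + 1) k, S.toPi0 = S'.toPi0 ∧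
      ∀ i j, S'.M i j = S.M i j + c * S.M 0 i * S.M 0 j := by
  have hS := S.isSymm.apply
  set E : Matrix (Fin (n + 1)) (Fin (n + 1)) k[X] :=
    1 + Matrix.of (Fin.cons (fun j => X * C (c * S.M 0 j)) fun _ => 0) with hE
  have hEdet : E.det = 1 := by
    rw [Matrix.det_of_isUpperTriangular]
    · refine Finset.prod_eq_one fun i _ => ?_
      refine Fin.cases ?_ (fun i => ?_) i <;> simp [hE, h]
    · intro i j
      refine Fin.cases (fun h => absurd h (Fin.not_lt_zero _)) (fun i hij => ?_) i
      have hij' : j < i.succ := hij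
      simp [hE, hij'.ne']
  have hM : ∀ i j, (S.const.M * E) i j = C (S.M i j) + X * C (c * S.M 0 i * S.M 0 j) := by
    intro i j
    rw [hE, Matrix.mul_add, Matrix.mul_one, Matrix.add_apply, Matrix.mul_apply,
      Fin.sum_univ_succ]
    simp [const, map, hS i 0]
    ring
  let H : SymMat (n + 1) k[X] := ⟨S.const.M * E, Matrix.IsSymm.ext fun i j => by
    rw [hM, hM, hS i j, mul_right_comm], by
    rw [Matrix.det_mul, hEdet, mul_one]; exact S.const.isUnit_det⟩
  have h0 : H.evalAt 0 = S := by
    ext i j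
    change eval 0 ((S.const.M * E) i j) = _
    rw [hM]; simp
  refine ⟨H.evalAt 1, ?_, fun i j => ?_⟩
  · rw [← toPi0_evalAt, h0]
  · change eval 1 ((S.const.M * E) i j) = _
    rw [hM]; simp

theorem exists_toPi0_eq_apply_zero_ne_zero (S : SymMat (n + 1) k) :
    ∃ S' : SymMat (n + 1) k, S.toPi0 = S'.toPi0 ∧ S'.M 0 0 ≠ 0 := by
  by_cases h : S.M 0 0 = 0
  swap
  · exact ⟨S, rfl, h⟩
  obtain ⟨j, hj⟩ : ∃ j, S.M 0 j ≠ 0 := by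
    by_contra! hc
    exact S.isUnit_det.ne_zero (Matrix.det_eq_zero_of_row_eq_zero 0 hc)
  have hj0 : j ≠ 0 := by rintro rfl; exact hj h
  -- The constant is chosen so that the vector e₀ + e_j has value 1 for the new form.
  obtain ⟨S', hS', hM⟩ := S.exists_toPi0_eq_of_apply_zero_eq_zero h
    ((1 - 2 * S.M 0 j - S.M j j) / S.M 0 j ^ 2)
  set U : Matrix (Fin (n + 1)) (Fin (n + 1)) k := 1 + Matrix.single j 0 1 with hU
  have hUd : ∀ i, U i i = 1 := fun i => by
    simp only [hU, Matrix.add_apply, Matrix.one_apply_eq, Matrix.single_apply]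
    rw [if_neg (by rintro ⟨rfl, rfl⟩; exact hj0 rfl), add_zero]
  have hUl : ∀ i l, i < l → U i l = 0 := fun i l hil => by
    simp only [hU, Matrix.add_apply, Matrix.one_apply_ne hil.ne, Matrix.single_apply]
    rw [if_neg (by rintro ⟨rfl, rfl⟩; exact absurd hil (Fin.not_lt_zero _)), add_zero]
  have hUdet : IsUnit U.det := by
    rw [Matrix.det_of_isLowerTriangular _ fun i l hil => hUl i l hil]
    simp [hUd]
  refine ⟨S'.congr U hUdet, hS'.trans (toPi0_eq_of_lower U hUd hUl rfl), ?_⟩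
  have : (S'.congr U hUdet).M 0 0 = S'.M 0 0 + S'.M 0 j + S'.M j 0 + S'.M j j := by
    change (U.transpose * S'.M * U) 0 0 = _
    rw [transpose_mul_mul_apply]
    have : ∀ x, U x 0 = (if x = 0 then 1 else 0) + if x = j then 1 else 0 := fun x => by
      simp [hU, Matrix.one_apply, Matrix.single_apply, eq_comm]
    simp [this, add_mul, mul_add, Finset.sum_add_distrib]
    ring
  have h1 : (S'.congr U hUdet).M 0 0 = 1 := by
    rw [this]
    simp only [hM, h, S.isSymm.apply 0 j]
    field_simp
    ring
  rw [h1]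
  exact one_ne_zero

/-- The graded monoid of naive connected components of symmetric matrices is generated by the
classes of the forms of rank one. -/
theorem mem_closure_rankOneClass (x : GradedMonoid (Pi0 k)) :
    x ∈ Submonoid.closure (Set.range (rankOneClass (k := k))) := by
  suffices key : ∀ n (S : SymMat n k), GradedMonoid.mk n S.toPi0 ∈
      Submonoid.closure (Set.range (rankOneClass (k := k))) by
    obtain ⟨n, ⟨S⟩⟩ := x
    exact key n S
  intro n
  induction n with
  | zero =>
    intro S
    have : S = zero := by ext i; exact i.elim0
    rw [this]
    exact Submonoid.one_mem _
  | succ n ih =>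
    intro S
    obtain ⟨S₁, h1, h0⟩ := S.exists_toPi0_eq_apply_zero_ne_zero
    obtain ⟨u, S', h⟩ := S₁.exists_mk_eq_rankOneClass_mul h0
    rw [h1, h]
    exact Submonoid.mul_mem _ (Submonoid.subset_closure ⟨u, rfl⟩) (ih S')

theorem rankOneClass_mul_comm (u : kˣ) (x : GradedMonoid (Pi0 k)) :
    rankOneClass u * x = x * rankOneClass u := by
  induction mem_closure_rankOneClass x using Submonoid.closure_induction with
  | mem x hx =>
    obtain ⟨v, rfl⟩ := hx
    exact rankOneClass_mul_rankOneClass_comm u v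
  | one => rw [mul_one, one_mul]
  | mul x y _ _ hx hy => rw [← mul_assoc, hx, mul_assoc, hy, mul_assoc]

/-- The determinant, as an invariant of naive connected components. -/
def Pi0.det : Pi0 k n → k :=
  Quot.lift (fun S => S.M.det) (by
    rintro _ _ ⟨H, rfl, rfl⟩
    have h : ∀ t, ((H.evalAt t).M).det = eval t H.M.det := fun t =>
      ((evalRingHom t).map_det H.M).symm
    -- A unit of `k[X]` is constant, so the determinant is the same at both ends.
    rw [h, h, eq_C_of_natDegree_eq_zero (natDegree_eq_zero_of_isUnit H.isUnit_det)]
    simp)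

theorem det_rankOneClass_mul (u : kˣ) (x : GradedMonoid (Pi0 k)) :
    (rankOneClass u * x).2.det = u * x.2.det := by
  obtain ⟨n, ⟨S⟩⟩ := x
  change ((rankOne u).add S).M.det = u * S.M.det
  rw [add, Matrix.det_reindex_self, Matrix.det_fromBlocks_zero₂₁]
  simp [rankOne]

end Field

end SymMat

/-! ### Generators of the naive connected components of rational functions -/

namespace RatFun

section Ring

universe u

variable {R : Type u} [CommRing R] {S : Type u} [CommRing S] {n m d : ℕ}

/-- The pointed rational function attached to a pair of coprime polynomials. -/
noncomputable def ofCoprime (A B : R[X]) (h1 : A.natDegree ≤ n) (h2 : A.coeff n = 1) (h3 : B.degree < n)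
    (h : IsCoprime A B) : RatFun n R :=
  ⟨A, B, h1, h2, h3, (isUnit_res_iff h1 h2 h3).2 h⟩

theorem isCoprime_C_right (A : R[X]) (b : Rˣ) : IsCoprime A (C (b : R)) :=
  ⟨0, C ((b⁻¹ : Rˣ) : R), by rw [zero_mul, zero_add, ← C_mul, Units.inv_mul, C_1]⟩

/-- The rational function `P / b` with constant denominator. -/
noncomputable def overConst (P : R[X]) (h1 : P.natDegree ≤ d) (h2 : P.coeff d = 1)
    (hd : 1 ≤ d) (b : Rˣ) : RatFun d R :=
  ofCoprime P (C (b : R)) h1 h2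
    (degree_C_le.trans_lt (by exact_mod_cast hd)) (isCoprime_C_right P b)

theorem overConst_UV (P : R[X]) (h1 : P.natDegree ≤ d) (h2 : P.coeff d = 1) (hd : 1 ≤ d)
    (b : Rˣ) : (overConst P h1 h2 hd b).U = 0 ∧ (overConst P h1 h2 hd b).V = C ((b⁻¹ : Rˣ) : R) := by
  refine IsBezout.unique h1 h2 (overConst P h1 h2 hd b).isBezout ?_
    (degree_C_le.trans_lt (by exact_mod_cast hd))
  rw [mul_zero, zero_add]
  change C (b : R) * C _ = 1
  rw [← C_mul, Units.mul_inv, C_1]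

/-- The rational function `X / u` of degree one. -/
noncomputable def rankOne (u : Rˣ) : RatFun 1 R :=
  overConst X natDegree_X_le coeff_X_one le_rfl u

theorem rankOne_add_A (u : Rˣ) (f : RatFun n R) :
    ((rankOne u).add f).A = X * f.A - C ((u⁻¹ : Rˣ) : R) * f.B := by
  rw [add_A, rankOne, (overConst_UV _ _ _ _ _).2]
  rfl

theorem rankOne_add_B (u : Rˣ) (f : RatFun n R) : ((rankOne u).add f).B = C (u : R) * f.A := by
  rw [add_B, rankOne, (overConst_UV _ _ _ _ _).1, zero_mul, add_zero]
  rfl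

theorem mk_mul_mk (f : RatFun n R) (g : RatFun m R) :
    (GradedMonoid.mk n f.toPi0 : GradedMonoid (Pi0 R)) * GradedMonoid.mk m g.toPi0 =
      GradedMonoid.mk (n + m) (f.add g).toPi0 := rfl

/-- The class of `X / u`. -/
noncomputable def rankOneClass (u : Rˣ) : GradedMonoid (Pi0 R) :=
  GradedMonoid.mk 1 (rankOne u).toPi0

theorem toPi0_eq_of_homotopy {f g : RatFun n R} (H : RatFun n R[X])
    (hA0 : H.A.map (evalRingHom 0) = f.A) (hB0 : H.B.map (evalRingHom 0) = f.B)
    (hA1 : H.A.map (evalRingHom 1) = g.A) (hB1 : H.B.map (evalRingHom 1) = g.B) :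
    f.toPi0 = g.toPi0 := by
  have e0 : H.evalAt 0 = f := RatFun.ext hA0 hB0
  have e1 : H.evalAt 1 = g := RatFun.ext hA1 hB1
  rw [← e0, ← e1, toPi0_evalAt]

theorem evalRingHom_comp_C (t : R) : (evalRingHom t).comp C = RingHom.id R := by
  ext; simp

/-- A unit denominator is coprime to every numerator, so the segment between two monic numerators is
a homotopy. -/
theorem toPi0_overConst_eq (P Q : R[X]) (h1 : P.natDegree ≤ d) (h2 : P.coeff d = 1)
    (h1' : Q.natDegree ≤ d) (h2' : Q.coeff d = 1) (hd : 1 ≤ d) (b : Rˣ) :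
    (overConst P h1 h2 hd b).toPi0 = (overConst Q h1' h2' hd b).toPi0 := by
  have hm : ∀ F : R[X], (F.map C).natDegree ≤ F.natDegree := fun F => natDegree_map_le
  refine toPi0_eq_of_homotopy (overConst (P.map C + C X * (Q.map C - P.map C)) ?_ ?_ hd
    (Units.map (C : R →+* R[X]).toMonoidHom b)) ?_ ?_ ?_ ?_
  · refine natDegree_add_le_of_degree_le ((hm P).trans h1) ((natDegree_C_mul_le _ _).trans ?_)
    exact (natDegree_sub_le_of_le ((hm Q).trans h1') ((hm P).trans h1)).trans (max_self d).le
  · simp [h2, h2']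
  · simp [overConst, ofCoprime, Polynomial.map_map, evalRingHom_comp_C]
  · simp [overConst, ofCoprime]
  · simp [overConst, ofCoprime, Polynomial.map_map, evalRingHom_comp_C]
  · simp [overConst, ofCoprime]

theorem isCoprime_X_pow (b : Rˣ) (t : R) (d : ℕ) :
    IsCoprime ((X : R[X]) ^ (d + 2)) (C (b : R) + C t * X ^ (d + 1)) := by
  apply IsCoprime.pow_left
  refine ⟨-(C ((b⁻¹ : Rˣ) : R) * C t * X ^ d), C ((b⁻¹ : Rˣ) : R), ?_⟩
  have : C (↑b⁻¹ : R) * C (b : R) = 1 := by rw [← C_mul, Units.inv_mul, C_1]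
  rw [pow_succ]
  linear_combination this

theorem degree_C_add_C_mul_X_pow_lt (b t : R) (d : ℕ) :
    (C b + C t * X ^ (d + 1)).degree < ((d + 2 : ℕ) : WithBot ℕ) := by
  refine (degree_add_le _ _).trans_lt (max_lt ?_ ?_)
  · exact degree_C_le.trans_lt (by exact_mod_cast Nat.succ_pos _)
  · exact (degree_C_mul_X_pow_le _ _).trans_lt (by exact_mod_cast Nat.lt_succ_self _)

/-- The rational function `X ^ (d + 2) / (b + t X ^ (d + 1))`. -/
noncomputable def perturbed (b : Rˣ) (t : R) (d : ℕ) : RatFun (d + 2) R :=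
  ofCoprime (X ^ (d + 2)) (C (b : R) + C t * X ^ (d + 1)) (natDegree_X_pow_le _)
    (coeff_X_pow_self _) (degree_C_add_C_mul_X_pow_lt _ _ _) (isCoprime_X_pow b t d)

/-- The denominator b + t X^(d+1) is a unit modulo X for every t, hence stays coprime to the power
of X. At t = 1 it is no longer constant, and the function can be split further by division. -/
theorem toPi0_X_pow_eq (b : Rˣ) (d : ℕ) :
    (overConst (X ^ (d + 2)) (natDegree_X_pow_le _) (coeff_X_pow_self _)
      (Nat.succ_le_succ (Nat.zero_le _)) b).toPi0 = (perturbed b 1 d).toPi0 := by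
  refine toPi0_eq_of_homotopy (perturbed (Units.map (C : R →+* R[X]).toMonoidHom b) X d)
    ?_ ?_ ?_ ?_
  all_goals simp [overConst, perturbed, ofCoprime]

/-- A section of the Bézout form in degree two. -/
noncomputable def ofSymMat (S : SymMat 2 R) : RatFun 2 R :=
  have hu : IsUnit (S.M 0 0 * S.M 1 1 - S.M 0 1 ^ 2) := by
    have := S.isUnit_det
    rwa [Matrix.det_fin_two, S.isSymm.apply 0 1, ← pow_two] at this
  -- With p, d, c the entries of S, the numerator X² + a₁X + a₀ over cX + d has Bézout matrix [a₁d -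
  -- a₀c, d; d, c]. The chosen coefficients solve a₁d - a₀c = p.
  ofCoprime
    (X ^ 2 + (C (-S.M 0 0 * S.M 0 1 * ↑hu.unit⁻¹) * X + C (-S.M 0 0 ^ 2 * ↑hu.unit⁻¹)))
    (C (S.M 1 1) * X + C (S.M 0 1))
    (by
      refine natDegree_add_le_of_degree_le (natDegree_X_pow_le _) ?_
      exact natDegree_linear_le.trans (by norm_num))
    (by
      rw [coeff_add, coeff_X_pow_self,
        coeff_eq_zero_of_natDegree_lt (natDegree_linear_le.trans_lt (by norm_num)), add_zero])
    (degree_linear_le.trans_lt (by exact_mod_cast Nat.lt_succ_self _))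
    (by
      have h := hu.unit.inv_mul
      rw [IsUnit.unit_spec] at h
      generalize (↑hu.unit⁻¹ : R) = e at h
      generalize S.M 0 0 = p at *
      generalize S.M 0 1 = d at *
      generalize S.M 1 1 = c at *
      have h' := congrArg (C : R → R[X]) h
      simp only [C_mul, C_sub, C_pow, C_1] at h'
      refine ⟨-C (c ^ 2 * e), C e * (C c * X + C (c * (-p * d * e)) - C d), ?_⟩
      simp only [C_mul, C_neg, C_pow]
      generalize C p = p at *
      generalize C d = d at *
      generalize C c = c at *
      generalize C e = e at *
      linear_combination (1 + p * c * e) * h')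

theorem ofSymMat_map (φ : R →+* S) (a : SymMat 2 R) :
    ofSymMat (a.map φ) = (ofSymMat a).map φ := by
  have key : ∀ (x : R) (hx : IsUnit x) (y : S) (hy : IsUnit y), y = φ x →
      (↑hy.unit⁻¹ : S) = φ ↑hx.unit⁻¹ := by
    rintro x hx y hy rfl
    rw [← Units.mul_right_inj hy.unit, Units.mul_inv, IsUnit.unit_spec, ← _root_.map_mul,
      IsUnit.mul_val_inv, _root_.map_one]
  have hu : IsUnit (a.M 0 0 * a.M 1 1 - a.M 0 1 ^ 2) := by
    have := a.isUnit_det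
    rwa [Matrix.det_fin_two, a.isSymm.apply 0 1, ← pow_two] at this
  have e : ∀ hy : IsUnit (φ (a.M 0 0) * φ (a.M 1 1) - φ (a.M 0 1) ^ 2),
      (↑hy.unit⁻¹ : S) = φ ↑hu.unit⁻¹ := fun hy => key _ hu _ hy (by simp)
  ext1
  · simp [ofSymMat, ofCoprime, map, SymMat.map, e]
  · simp [ofSymMat, ofCoprime, map, SymMat.map]

/-- The map induced by `ofSymMat` on naive connected components. -/
noncomputable def pi0OfSymMat : SymMat.Pi0 R 2 → Pi0 R 2 :=
  Quot.lift (fun a => (ofSymMat a).toPi0) (by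
    rintro _ _ ⟨H, rfl, rfl⟩
    rw [SymMat.evalAt, SymMat.evalAt, ofSymMat_map, ofSymMat_map]
    exact toPi0_evalAt (ofSymMat H))

/-- The sum X/u ⊕ X/v is (X² - v/u)/(uX), the value of the section at diag(v, u). Homotopies of
binary forms thus give relations between the X/u. -/
theorem rankOneClass_mul_rankOneClass (u v : Rˣ) (h : IsUnit ((v : R) * u - 0 ^ 2)) :
    rankOneClass u * rankOneClass v =
      GradedMonoid.mk 2 (pi0OfSymMat (SymMat.binary (v : R) 0 (u : R) h).toPi0) := by
  rw [rankOneClass, rankOneClass, mk_mul_mk]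
  change _ = GradedMonoid.mk 2 (ofSymMat _).toPi0
  refine mk_toPi0_eq rfl ?_ ?_
  · rw [rankOne_add_A]
    have key : ∀ hy : IsUnit ((v : R) * u - 0 ^ 2), (-(v : R) ^ 2 * ↑hy.unit⁻¹) = -(↑u⁻¹ * v) := by
      intro hy
      have : hy.unit = v * u := Units.ext (by simp)
      rw [this, mul_inv_rev, Units.val_mul]
      have h1 : (v : R) * ↑v⁻¹ = 1 := Units.mul_inv v
      linear_combination (-(v : R) * ↑u⁻¹) * h1
    change X * X - C ((u⁻¹ : Rˣ) : R) * C (v : R) =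
      X ^ 2 + (C (-(v : R) * 0 * ↑h.unit⁻¹) * X + C (-(v : R) ^ 2 * ↑h.unit⁻¹))
    rw [key h]
    simp
    ring
  · rw [rankOne_add_B]
    change C (u : R) * X = C (u : R) * X + C 0
    simp

end Ring

/-! ### Rational functions over a field: generators and relations -/

section Field

universe u

variable {k : Type u} [Field k] {n m : ℕ}

/-- One step of the continued fraction: write B = b A' with A' monic and A = P A' + r. Since P/b has
U = 0 and V = 1/b, A/B is P/b ⊕ A'/(-b r). -/
theorem exists_mk_eq_overConst_mul (f : RatFun n k) (hn : 1 ≤ n) :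
    f.B.natDegree < n ∧ ∃ (d : ℕ) (P : k[X]) (h1 : P.natDegree ≤ d) (h2 : P.coeff d = 1)
      (hd : 1 ≤ d) (b : kˣ) (g : RatFun f.B.natDegree k), n = d + f.B.natDegree ∧
      GradedMonoid.mk n f.toPi0 =
        GradedMonoid.mk d (overConst P h1 h2 hd b).toPi0 * GradedMonoid.mk _ g.toPi0 := by
  have hA := f.monic
  have hAn : f.A.natDegree = n := natDegree_eq_of_degree_eq_some f.degree_A
  have hB0 : f.B ≠ 0 := by
    intro h0
    have hc := f.isCoprime
    rw [h0, isCoprime_zero_right] at hc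
    have := natDegree_eq_zero_of_isUnit hc
    omega
  set m := f.B.natDegree with hm
  have hmn : m < n := by
    have := f.degree_B_lt
    rw [degree_eq_natDegree hB0] at this
    exact_mod_cast this
  refine ⟨hmn, ?_⟩
  set b := f.B.leadingCoeff with hb
  have hb0 : b ≠ 0 := leadingCoeff_ne_zero.2 hB0
  set A' := f.B * C b⁻¹ with hA'
  have hA'm : A'.Monic := monic_mul_leadingCoeff_inv hB0
  have hA'd : A'.natDegree = m := natDegree_mul_leadingCoeff_inv _ hB0
  have hBA' : C b * A' = f.B := by
    rw [hA', mul_comm, mul_assoc, ← C_mul, inv_mul_cancel₀ hb0, C_1, mul_one]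
  set P := f.A /ₘ A' with hP
  set r := f.A %ₘ A' with hr
  have hdiv : r + A' * P = f.A := modByMonic_add_div f.A A'
  have hPm : P.natDegree = n - m := by rw [hP, natDegree_divByMonic _ hA'm, hAn, hA'd]
  have hPmonic : P.Monic := by
    rw [hP, Monic, leadingCoeff_divByMonic_of_monic hA'm, hA.leadingCoeff]
    rw [degree_eq_natDegree hA'm.ne_zero, degree_eq_natDegree hA.ne_zero, hA'd, hAn]
    exact_mod_cast hmn.le
  have hrd : r.degree < m := by
    have := degree_modByMonic_lt f.A hA'm
    rwa [degree_eq_natDegree hA'm.ne_zero, hA'd] at this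
  have hcop : IsCoprime A' (-(C b * r)) := by
    obtain ⟨x, y, hxy⟩ := f.isCoprime
    have hbb : C b * C b⁻¹ = (1 : k[X]) := by rw [← C_mul, mul_inv_cancel₀ hb0, C_1]
    refine ⟨x * P + y * C b, -(C b⁻¹ * x), ?_⟩
    linear_combination hxy + x * hdiv + y * hBA' + x * r * hbb
  refine ⟨n - m, P, hPm.le, by rw [← hPm]; exact hPmonic, by omega, Units.mk0 b hb0,
    ofCoprime A' (-(C b * r)) hA'd.le (by rw [← hA'd]; exact hA'm) ?_ hcop, by omega, ?_⟩
  · rw [degree_neg, degree_C_mul hb0]; exact hrd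
  · rw [mk_mul_mk]
    refine mk_toPi0_eq (by omega) ?_ ?_
    · rw [add_A, (overConst_UV _ _ _ _ _).2]
      change f.A = P * A' - C b⁻¹ * -(C b * r)
      have hbb : C b⁻¹ * C b = (1 : k[X]) := by rw [← C_mul, inv_mul_cancel₀ hb0, C_1]
      linear_combination -hdiv - r * hbb
    · rw [add_B, (overConst_UV _ _ _ _ _).1]
      change f.B = C b * A' + 0 * _
      rw [hBA', zero_mul, add_zero]

/-- The graded monoid of naive connected components of pointed rational functions is generated
by the classes of the functions `X / u`. -/
theorem mem_closure_rankOneClass (x : GradedMonoid (Pi0 k)) :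
    x ∈ Submonoid.closure (Set.range (rankOneClass (R := k))) := by
  suffices key : ∀ n (f : RatFun n k), GradedMonoid.mk n f.toPi0 ∈
      Submonoid.closure (Set.range (rankOneClass (R := k))) by
    obtain ⟨n, ⟨f⟩⟩ := x
    exact key n f
  intro n
  induction n using Nat.strong_induction_on with
  | _ n ih =>
  -- If B is not constant, both summands have degree smaller than n.
  have step : ∀ f : RatFun n k, 1 ≤ f.B.natDegree → GradedMonoid.mk n f.toPi0 ∈
      Submonoid.closure (Set.range (rankOneClass (R := k))) := by
    intro f hf
    rcases Nat.eq_zero_or_pos n with rfl | hn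
    · have hB : f.B = 0 := by simpa [Nat.WithBot.lt_zero_iff] using f.degree_B_lt
      simp [hB] at hf
    obtain ⟨hlt, d, P, h1, h2, hd, b, g, hdn, e⟩ := f.exists_mk_eq_overConst_mul hn
    rw [e]
    exact Submonoid.mul_mem _ (ih d (by omega) _) (ih _ hlt g)
  intro f
  rcases Nat.eq_zero_or_pos n with rfl | hn
  · have hA : f.A = 1 := by
      have := f.coeff_A
      rw [eq_C_of_natDegree_le_zero f.natDegree_A_le, this, C_1]
    have hB : f.B = 0 := by simpa [Nat.WithBot.lt_zero_iff] using f.degree_B_lt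
    rw [mk_toPi0_eq (g := zero) rfl hA hB]
    exact Submonoid.one_mem _
  by_cases hB : 1 ≤ f.B.natDegree
  · exact step f hB
  obtain ⟨hlt, d, P, h1, h2, hd, b, g, hdn, e⟩ := f.exists_mk_eq_overConst_mul hn
  rw [e]
  refine Submonoid.mul_mem _ ?_ (ih _ hlt g)
  obtain rfl : d = n := by omega
  obtain _ | _ | d := d
  · omega
  · rw [toPi0_overConst_eq P X h1 h2 natDegree_X_le coeff_X_one hd b]
    exact Submonoid.subset_closure ⟨b, rfl⟩
  -- A constant denominator gives no smaller degree. Perturbing it to b + X^(d+1) makes the previous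
  -- case apply.
  · rw [toPi0_overConst_eq P (X ^ (d + 2)) h1 h2 (natDegree_X_pow_le _) (coeff_X_pow_self _) hd b,
      toPi0_X_pow_eq]
    apply step
    change 1 ≤ (C (b : k) + C 1 * X ^ (d + 1)).natDegree
    rw [add_comm, natDegree_add_C, C_1, one_mul, natDegree_X_pow]
    omega

/-- Generators commute because diag(v, u) and diag(u, v) are joined by a homotopy, which the section
in degree two transports; generation does the rest. -/
theorem pi0_mul_comm (x y : GradedMonoid (Pi0 k)) : x * y = y * x := by
  have h1 : ∀ u v : kˣ, rankOneClass u * rankOneClass v = rankOneClass v * rankOneClass u := by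
    intro u v
    rw [rankOneClass_mul_rankOneClass u v (by simp), rankOneClass_mul_rankOneClass v u (by simp)]
    have := SymMat.toPi0_binary_diag (a := (u : k)) (b := v) (x := 0) (y := 1) (a' := v) (by ring)
      v.ne_zero (by simp) (by simp)
    rw [this]
    congr 4
    field_simp
  have h2 : ∀ (u : kˣ) (y : GradedMonoid (Pi0 k)), rankOneClass u * y = y * rankOneClass u := by
    intro u y
    induction mem_closure_rankOneClass y using Submonoid.closure_induction with
    | mem x hx =>
      obtain ⟨v, rfl⟩ := hx
      exact h1 u v
    | one => rw [mul_one, one_mul]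
    | mul x y _ _ hx hy => rw [← mul_assoc, hx, mul_assoc, hy, mul_assoc]
  induction mem_closure_rankOneClass x using Submonoid.closure_induction with
  | mem x hx =>
    obtain ⟨v, rfl⟩ := hx
    exact h2 v y
  | one => rw [mul_one, one_mul]
  | mul x z _ _ hx hz => rw [mul_assoc, hz, ← mul_assoc, hx, mul_assoc]

/-- The graded monoid of naive connected components of pointed rational functions over a field is
commutative. -/
@[reducible]
noncomputable def commMonoidPi0 : CommMonoid (GradedMonoid (Pi0 k)) :=
  { (inferInstance : Monoid (GradedMonoid (Pi0 k))) with mul_comm := pi0_mul_comm }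

open Classical in
/-- The class of `X / u`, as a function on the field. -/
noncomputable def rankOneVal (u : k) : GradedMonoid (Pi0 k) :=
  -- The value at 0 is arbitrary: the relations and decompositions only use nonzero arguments.
  if h : u = 0 then 1 else rankOneClass (Units.mk0 u h)

theorem rankOneVal_units (u : kˣ) : rankOneVal (u : k) = rankOneClass u := by
  rw [rankOneVal, dif_neg u.ne_zero, Units.mk0_val]

theorem rankOneVal_mul {a b : k} (ha : a ≠ 0) (hb : b ≠ 0) (h : IsUnit (b * a - 0 ^ 2)) :
    rankOneVal a * rankOneVal b =
      GradedMonoid.mk 2 (pi0OfSymMat (SymMat.binary b 0 a h).toPi0) := by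
  rw [rankOneVal, rankOneVal, dif_neg ha, dif_neg hb]
  exact rankOneClass_mul_rankOneClass (Units.mk0 a ha) (Units.mk0 b hb) h

theorem isBinaryLaw_rankOneVal :
    letI := commMonoidPi0 (k := k)
    IsBinaryLaw (rankOneVal (k := k)) := by
  let _ := commMonoidPi0 (k := k)
  constructor
  · intro a b x y ha hb h0
    refine (rankOneVal_mul ha hb (by simp [ha, hb])).trans ?_
    refine Eq.trans ?_ (rankOneVal_mul h0 (div_ne_zero (mul_ne_zero ha hb) h0)
      (by simp [ha, hb, h0])).symm
    rw [SymMat.toPi0_binary_diag rfl h0]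
  · intro c d hc hd
    have hc2 : -c ^ 2 ≠ 0 := neg_ne_zero.2 (pow_ne_zero 2 hc)
    refine (rankOneVal_mul hd (div_ne_zero hc2 hd) (by simp [hc, hd])).trans ?_
    refine Eq.trans ?_ (rankOneVal_mul one_ne_zero hc2 (by simp [hc])).symm
    rw [SymMat.toPi0_binary_hyperbolic hd]

end Field

end RatFun

/-! ### The Bézout form of a sum -/

section BezoutSum

universe u

variable {R : Type u} [CommRing R] {n : ℕ}

theorem bezPoly_rankOne_add (u : Rˣ) (f : RatFun n R) :
    bezPoly ((RatFun.rankOne u).add f).A ((RatFun.rankOne u).add f).B =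
      C (C (u : R) * f.A) * f.A.map C + bezPoly f.A f.B := by
  apply (monic_X_sub_C (X : R[X])).isRegular.left
  change (X - C X) * _ = (X - C X) * _
  rw [mul_add, X_sub_Y_mul_bezPoly, X_sub_Y_mul_bezPoly, RatFun.rankOne_add_A,
    RatFun.rankOne_add_B]
  have h : (C (C (↑u⁻¹ : R)) * C (C (u : R)) : R[X][X]) = 1 := by
    rw [← C_mul, ← C_mul, Units.inv_mul, C_1, C_1]
  simp only [bezNum, Polynomial.map_sub, Polynomial.map_mul, map_X, map_C, C_sub, C_mul]
  linear_combination (C f.B * f.A.map C - f.B.map C * C f.A) * h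

theorem bezPoly_coeff_of_le (f : RatFun n R) {p : ℕ} (hp : n ≤ p) :
    (bezPoly f.A f.B).coeff p = 0 := by
  rcases Nat.eq_zero_or_pos n with rfl | hn
  · have hB : f.B = 0 := by
      have := f.degree_B_lt
      rw [← degree_eq_bot]
      exact Nat.WithBot.lt_zero_iff.1 this
    simp [bezPoly, bezNum, hB]
  · exact bezPoly_coeff_eq_zero f hn hp

/-- The map induced by the Bézout forms on the graded monoids of naive connected components. -/
noncomputable def gradedBez (x : GradedMonoid (RatFun.Pi0 R)) : GradedMonoid (SymMat.Pi0 R) :=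
  GradedMonoid.mk x.1 (pi0Bez R x.1 x.2)

theorem gradedBez_one : gradedBez (1 : GradedMonoid (RatFun.Pi0 R)) = 1 := by
  change GradedMonoid.mk 0 (RatFun.zero : RatFun 0 R).bez.toPi0 =
    GradedMonoid.mk 0 (SymMat.zero : SymMat 0 R).toPi0
  congr 2
  ext i
  exact i.elim0

variable {k : Type u} [Field k]

/-- By `bezPoly_rankOne_add` the new form is that of f plus u times the square of the linear form
given by the coefficients of A. As A is monic of degree n, that linear form completes the first n
coordinates by a unipotent change of variables. -/
theorem gradedBez_rankOneClass_mul (u : kˣ) (x : GradedMonoid (RatFun.Pi0 k)) :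
    gradedBez (RatFun.rankOneClass u * x) = SymMat.rankOneClass u * gradedBez x := by
  obtain ⟨n, ⟨f⟩⟩ := x
  rw [SymMat.rankOneClass_mul_comm]
  change GradedMonoid.mk (1 + n) ((RatFun.rankOne u).add f).bez.toPi0 =
    GradedMonoid.mk (n + 1) (f.bez.add (SymMat.rankOne u)).toPi0
  set h := (RatFun.rankOne u).add f with hh
  -- The same function, with its degree written n + 1 so that the new coordinate comes last.
  let h' : RatFun (n + 1) k :=
    ⟨h.A, h.B, add_comm 1 n ▸ h.natDegree_A_le, add_comm 1 n ▸ h.coeff_A,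
      add_comm 1 n ▸ h.degree_B_lt, add_comm 1 n ▸ h.isUnit_res⟩
  have e : GradedMonoid.mk (1 + n) h.bez.toPi0 =
      (GradedMonoid.mk (n + 1) h'.bez.toPi0 : GradedMonoid (SymMat.Pi0 k)) :=
    SymMat.mk_toPi0_eq (add_comm 1 n) fun i j => rfl
  rw [e]
  congr 1
  symm
  have hA : f.A.coeff n = 1 := f.coeff_A
  set U : Matrix (Fin (n + 1)) (Fin (n + 1)) k :=
    Matrix.of fun i j => if i = Fin.last n then f.A.coeff j else if i = j then 1 else 0 with hU
  have hUlast : ∀ j, U (Fin.last n) j = f.A.coeff j := fun j => by simp [hU]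
  have hUcast : ∀ (i : Fin n) j, U i.castSucc j = if i.castSucc = j then 1 else 0 := fun i j => by
    simp [hU, Fin.castSucc_ne_last]
  refine SymMat.toPi0_eq_of_lower U ?_ ?_ ?_
  · intro i
    refine Fin.lastCases ?_ (fun i => ?_) i
    · rw [hUlast, Fin.val_last, hA]
    · rw [hUcast, if_pos rfl]
  · intro i j hij
    rw [hU, Matrix.of_apply, if_neg (hij.trans_le (Fin.le_last j)).ne, if_neg hij.ne]
  · have hcc : ∀ i j : Fin n, (f.bez.add (SymMat.rankOne u)).M i.castSucc j.castSucc =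
        f.bez.M i j := SymMat.add_M_castAdd_castAdd _ _
    have hcl : ∀ i : Fin n, (f.bez.add (SymMat.rankOne u)).M i.castSucc (Fin.last n) = 0 :=
      fun i => SymMat.add_M_castAdd_natAdd f.bez (SymMat.rankOne u) i 0
    have hlc : ∀ i : Fin n, (f.bez.add (SymMat.rankOne u)).M (Fin.last n) i.castSucc = 0 :=
      fun i => SymMat.add_M_natAdd_castAdd f.bez (SymMat.rankOne u) 0 i
    have hll : (f.bez.add (SymMat.rankOne u)).M (Fin.last n) (Fin.last n) = u :=
      SymMat.add_M_natAdd_natAdd f.bez (SymMat.rankOne u) 0 0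
    have hM : ∀ i j : Fin (n + 1), h'.bez.M i j =
        u * f.A.coeff i * f.A.coeff j + ((bezPoly f.A f.B).coeff i).coeff j := by
      intro i j
      change ((bezPoly h.A h.B).coeff i).coeff j = _
      rw [hh, bezPoly_rankOne_add, coeff_add, coeff_add, coeff_C_mul, coeff_map, coeff_mul_C,
        coeff_C_mul]
      ring
    have hz : ∀ i, ((bezPoly f.A f.B).coeff i).coeff n = 0 := fun i => by
      rw [bezPoly_coeff_symm, bezPoly_coeff_of_le f le_rfl, coeff_zero]
    ext1 i j
    rw [hM, transpose_mul_mul_apply]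
    simp only [Fin.sum_univ_castSucc, hcc, hcl, hlc, hll, hUlast, hUcast, mul_zero, zero_mul,
      Finset.sum_const_zero, add_zero, zero_add]
    refine Fin.lastCases ?_ (fun i => ?_) i <;> refine Fin.lastCases ?_ (fun j => ?_) j
    · simp [Fin.castSucc_ne_last, bezPoly_coeff_of_le f le_rfl, hA]
    · simp [Fin.castSucc_ne_last, bezPoly_coeff_of_le f le_rfl, hA]
    · simp [Fin.castSucc_ne_last, hz, hA, mul_comm]
    · simp [RatFun.bez, bezMatrix]; ring

theorem gradedBez_rankOneClass (u : kˣ) :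
    gradedBez (RatFun.rankOneClass u) = SymMat.rankOneClass u := by
  rw [← mul_one (RatFun.rankOneClass u), gradedBez_rankOneClass_mul, gradedBez_one, mul_one]

theorem gradedBez_mul (x y : GradedMonoid (RatFun.Pi0 k)) :
    gradedBez (x * y) = gradedBez x * gradedBez y := by
  induction RatFun.mem_closure_rankOneClass x using Submonoid.closure_induction generalizing y with
  | mem x hx =>
    obtain ⟨u, rfl⟩ := hx
    rw [gradedBez_rankOneClass_mul, gradedBez_rankOneClass]
  | one => rw [one_mul, gradedBez_one, one_mul]
  | mul x z _ _ hx hz => rw [mul_assoc, hx, hz, hx, mul_assoc]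

theorem gradedBez_surjective : Function.Surjective (gradedBez (R := k)) := by
  intro y
  induction SymMat.mem_closure_rankOneClass y using Submonoid.closure_induction with
  | mem x hx =>
    obtain ⟨u, rfl⟩ := hx
    exact ⟨_, gradedBez_rankOneClass u⟩
  | one => exact ⟨1, gradedBez_one⟩
  | mul x z _ _ hx hz =>
    obtain ⟨a, rfl⟩ := hx
    obtain ⟨b, rfl⟩ := hz
    exact ⟨a * b, gradedBez_mul a b⟩

end BezoutSum

/-! ### The classifying invariant of symmetric matrices -/

section Classifying

universe u

variable {k : Type u} [Field k] {M : Type*} [CommMonoid M] {n : ℕ}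

/-- The bilinear form with matrix `S`. -/
noncomputable def SymMat.form {R : Type*} [CommRing R] (S : SymMat n R) :
    LinearMap.BilinForm R (Fin n → R) :=
  Matrix.toBilin' S.M

theorem SymMat.form_apply {R : Type*} [CommRing R] (S : SymMat n R) (x y : Fin n → R) :
    S.form x y = ∑ i, ∑ j, x i * S.M i j * y j := by
  rw [form, Matrix.toBilin'_apply]

theorem SymMat.form_symm {R : Type*} [CommRing R] (S : SymMat n R) (x y : Fin n → R) :
    S.form x y = S.form y x := by
  rw [form_apply, form_apply, Finset.sum_comm]
  refine Finset.sum_congr rfl fun i _ => Finset.sum_congr rfl fun j _ => ?_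
  rw [S.isSymm.apply]
  ring

theorem SymMat.unimodularOn_top {R : Type*} [CommRing R] (S : SymMat n R) :
    UnimodularOn S.form ⊤ := by
  intro f
  set c : Fin n → R := fun i => f ⟨Pi.single i 1, trivial⟩ with hc
  refine ⟨Matrix.vecMul c S.M⁻¹, trivial, fun x => ?_⟩
  have h1 : S.form (Matrix.vecMul c S.M⁻¹) x = c ⬝ᵥ (x : Fin n → R) := by
    rw [form, Matrix.toBilin'_apply', Matrix.dotProduct_mulVec, Matrix.vecMul_vecMul,
      Matrix.nonsing_inv_mul _ S.isUnit_det, Matrix.vecMul_one]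
  have h2 : x = ∑ i, (x : Fin n → R) i • (⟨Pi.single i 1, trivial⟩ : (⊤ : Submodule R (Fin n → R))) := by
    ext j
    simp [Finset.sum_apply, Pi.single_apply]
  rw [h1]
  conv_lhs => rw [h2]
  simp [dotProduct, hc, mul_comm]

/-- Evaluation of vectors of polynomials at `t`. -/
noncomputable def evalVec (n : ℕ) (t : k) : (Fin n → k[X]) →ₛₗ[evalRingHom t] (Fin n → k) where
  toFun x i := (x i).eval t
  map_add' x y := by ext; simp
  map_smul' c x := by ext; simp

theorem evalVec_surjective (t : k) : Function.Surjective (evalVec n t) := fun y =>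
  ⟨fun i => C (y i), by ext; simp [evalVec]⟩

theorem form_evalVec (H : SymMat n k[X]) (t : k) (x y : Fin n → k[X]) :
    (H.evalAt t).form (evalVec n t x) (evalVec n t y) = (H.form x y).eval t := by
  simp [SymMat.form_apply, evalVec, eval_finsetSum, SymMat.evalAt, SymMat.map]

/-- The discriminants and classes of the orthogonal decompositions of a symmetric matrix. -/
def SymMat.decompositions (g : k → M) (S : SymMat n k) : Set (k × M) :=
  {p | OrthVal S.form g ⊤ p.1 p.2}

/-- All fibres share a pair for each c, and c is chosen to match the given discriminant at s.
Uniqueness at s then identifies the class, and the shared pair also occurs at t. -/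
theorem decompositions_evalAt_subset {g : k → M} (hg : IsBinaryLaw g) (H : SymMat n k[X])
    (s t : k) : (H.evalAt s).decompositions g ⊆ (H.evalAt t).decompositions g := by
  rintro ⟨δ, x⟩ (hx : OrthVal _ g ⊤ δ x)
  change OrthVal _ g ⊤ δ x
  obtain ⟨δ₀, h⟩ := H.unimodularOn_top.exists_orthVal H.form_symm
    (Bt := fun t => (H.evalAt t).form) (ev := evalVec n) (form_evalVec H) g
  have htop : ∀ t, (⊤ : Submodule k[X] (Fin n → k[X])).map (evalVec n t) = ⊤ := fun t => by
    rw [Submodule.map_top, LinearMap.range_eq_top]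
    exact evalVec_surjective t
  simp only [htop] at h
  have hs := (H.evalAt s).form_symm
  obtain ⟨x₀, h₀⟩ := h 1 one_ne_zero fun _ => rfl
  obtain ⟨⟨c, hc, rfl⟩, heq⟩ := OrthVal.unique hs hg ⊤ _ _ _ _ (h₀ s) hx
  by_cases hbot : (⊤ : Submodule k[X] (Fin n → k[X])) = ⊥
  · have hbot' : (⊤ : Submodule k (Fin n → k)) = ⊥ := by
      rw [← htop 0, hbot, Submodule.map_bot]
    have h1 := h₀ t
    have h2 := h₀ s
    rw [hbot'] at hx h1 h2 ⊢
    obtain ⟨e1, rfl⟩ := hx.of_bot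
    obtain ⟨e2, rfl⟩ := h2.of_bot
    rw [e1]
    rwa [e2] at h1
  · obtain ⟨x₁, h₁⟩ := h c hc fun e => absurd e hbot
    have : x₁ = x := (OrthVal.unique hs hg ⊤ _ _ _ _ (h₁ s) hx).2 (by ring)
    rw [← this]
    convert h₁ t using 1
    ring

/-- The set of decompositions, as an invariant of naive connected components. -/
def SymMat.Pi0.decompositions {g : k → M} (hg : IsBinaryLaw g) : SymMat.Pi0 k n → Set (k × M) :=
  Quot.lift (SymMat.decompositions g) (by
    rintro _ _ ⟨H, rfl, rfl⟩
    exact (decompositions_evalAt_subset hg H 0 1).antisymm (decompositions_evalAt_subset hg H 1 0))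

theorem SymMat.Pi0.decompositions_unique {g : k → M} (hg : IsBinaryLaw g) {x : SymMat.Pi0 k n}
    {δ : k} {a b : M} (ha : (δ, a) ∈ x.decompositions hg) (hb : (δ, b) ∈ x.decompositions hg) :
    a = b := by
  obtain ⟨S⟩ := x
  exact (OrthVal.unique S.form_symm hg ⊤ _ _ _ _ ha hb).2 rfl

theorem OrthVal.map {V V' : Type*} [AddCommGroup V] [Module k V] [AddCommGroup V'] [Module k V']
    {B : LinearMap.BilinForm k V} {B' : LinearMap.BilinForm k V'} {g : k → M} (j : V →ₗ[k] V')
    (hj : ∀ x y, B' (j x) (j y) = B x y) {W : Submodule k V} {δ : k} {x : M}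
    (H : OrthVal B g W δ x) : OrthVal B' g (W.map j) δ x := by
  have hperp : ∀ (W : Submodule k V) v, (perp B W v).map j = perp B' (W.map j) (j v) := by
    intro W v
    ext y
    simp only [mem_perp, Submodule.mem_map]
    constructor
    · rintro ⟨x, ⟨hx, h⟩, rfl⟩
      exact ⟨⟨x, hx, rfl⟩, by rw [hj, h]⟩
    · rintro ⟨⟨x, hx, rfl⟩, h⟩
      exact ⟨x, ⟨hx, by rw [← hj, h]⟩, rfl⟩
  induction H with
  | bot => rw [Submodule.map_bot]; exact OrthVal.bot
  | line hv h _ ih =>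
    rw [hperp] at ih
    have := ih.line (Submodule.mem_map_of_mem hv) (by rwa [hj])
    rwa [hj] at this
  | plane hr hz h0 h _ ih =>
    rw [hperp, hperp] at ih
    have := ih.plane (Submodule.mem_map_of_mem hr) (Submodule.mem_map_of_mem hz) (by rwa [hj])
      (by rwa [hj])
    rwa [hj] at this

theorem SymMat.orthVal_rankOne_add {g : k → M} (u : kˣ) {S : SymMat n k} {δ : k} {x : M}
    (H : OrthVal S.form g ⊤ δ x) :
    OrthVal ((rankOne u).add S).form g ⊤ (u * δ) (g u * x) := by
  set T := (rankOne u).add S with hT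
  let j : (Fin n → k) →ₗ[k] (Fin (1 + n) → k) :=
    { toFun := fun y => Fin.addCases (fun _ => 0) y
      map_add' := fun y z => by
        ext i
        induction i using Fin.addCases <;> simp
      map_smul' := fun c y => by
        ext i
        induction i using Fin.addCases <;> simp }
  have hjl : ∀ y i, j y (Fin.castAdd n i) = 0 := fun y i => by simp [j]
  have hjr : ∀ y i, j y (Fin.natAdd 1 i) = y i := fun y i => by simp [j]
  have hj : ∀ y z, T.form (j y) (j z) = S.form y z := fun y z => by
    simp only [form_apply, Fin.sum_univ_add, hjl, hjr, hT, add_M_natAdd_natAdd]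
    simp
  set v : Fin (1 + n) → k := Pi.single (Fin.castAdd n 0) 1 with hv
  have hvw : ∀ w, T.form v w = u * w (Fin.castAdd n 0) := fun w => by
    rw [form_apply, Finset.sum_eq_single (Fin.castAdd n 0)]
    · simp only [Fin.sum_univ_add, hT, add_M_castAdd_natAdd, add_M_castAdd_castAdd]
      simp [hv, rankOne]
    · intro b _ hb
      simp [hv, hb]
    · simp
  -- The orthogonal of the first basis vector is the isometric copy of the space of S, whose
  -- decomposition continues the line ⟨u⟩.
  have hperp : perp T.form ⊤ v = (⊤ : Submodule k (Fin n → k)).map j := by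
    ext w
    simp only [mem_perp, Submodule.mem_top, true_and, hvw, Submodule.mem_map]
    constructor
    · intro h
      refine ⟨fun i => w (Fin.natAdd 1 i), funext fun i => ?_⟩
      induction i using Fin.addCases with
      | left i =>
        rw [hjl, Subsingleton.elim i 0]
        exact ((mul_eq_zero.1 h).resolve_left u.ne_zero).symm
      | right i => rw [hjr]
    · rintro ⟨y, rfl⟩
      rw [hjl, mul_zero]
  have hvv : T.form v v = u := by rw [hvw]; simp [hv]
  have H' := H.map j hj
  rw [← hperp] at H'
  have := H'.line Submodule.mem_top (by rw [hvv]; exact u.ne_zero)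
  rwa [hvv] at this

end Classifying

/-! ### Injectivity of the Bézout map -/

section Injective

universe u

variable {k : Type u} [Field k]

/-- Writing x as a product of classes X/u decomposes its Bézout form into the lines ⟨u⟩, with class
x by construction. -/
theorem det_mem_decompositions_gradedBez (x : GradedMonoid (RatFun.Pi0 k)) :
    let _ := RatFun.commMonoidPi0 (k := k)
    ((gradedBez x).2.det, x) ∈
      (gradedBez x).2.decompositions (RatFun.isBinaryLaw_rankOneVal (k := k)) := by
  intro _
  induction RatFun.mem_closure_rankOneClass x using Submonoid.closure_induction_left with
  | one =>
    rw [gradedBez_one]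
    change OrthVal (SymMat.zero : SymMat 0 k).form RatFun.rankOneVal ⊤
      (SymMat.zero : SymMat 0 k).M.det 1
    have : (⊤ : Submodule k (Fin 0 → k)) = ⊥ := Subsingleton.elim _ _
    rw [this, Matrix.det_fin_zero]
    exact OrthVal.bot
  | mul_left x hx y _ ih =>
    obtain ⟨u, rfl⟩ := hx
    rw [gradedBez_rankOneClass_mul, SymMat.det_rankOneClass_mul, ← RatFun.rankOneVal_units]
    generalize gradedBez y = z at ih
    obtain ⟨n, ⟨S⟩⟩ := z
    exact SymMat.orthVal_rankOne_add u ih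

/-- If the images agree, x and y are classes of decompositions of one form with the same
discriminant, hence equal. -/
theorem gradedBez_injective : Function.Injective (gradedBez (R := k)) := by
  intro x y h
  let _ := RatFun.commMonoidPi0 (k := k)
  have hx := det_mem_decompositions_gradedBez x
  have hy := det_mem_decompositions_gradedBez y
  rw [h] at hx
  exact SymMat.Pi0.decompositions_unique _ hx hy

/-- The isomorphism of graded monoids induced by the Bézout forms. -/
noncomputable def gradedBezEquiv : GradedMonoid (RatFun.Pi0 k) ≃* GradedMonoid (SymMat.Pi0 k) :=
  MulEquiv.mk (Equiv.ofBijective gradedBez ⟨gradedBez_injective, gradedBez_surjective⟩)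
    gradedBez_mul

end Injective

end NaiveP1

theorem theorem3p1 (k : Type*) [Field k] :
    ∃ Φ : GradedMonoid (NaiveP1.RatFun.Pi0 k) ≃* GradedMonoid (NaiveP1.SymMat.Pi0 k),
      ∀ (n : ℕ) (x : NaiveP1.RatFun.Pi0 k n),
        Φ (GradedMonoid.mk n x) = GradedMonoid.mk n (NaiveP1.pi0Bez k n x) :=
  ⟨NaiveP1.gradedBezEquiv, fun _ _ => rfl⟩
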